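/- Let $(W,S)$ be a finite Coxeter system with set of reflections $T=\{wsw^{-1}: w\in W, s\in S\}$, absolute length $\ell$ (the length with respect to $T$) and absolute order $v\le w:\Leftrightarrow \ell(w)=\ell(v)+\ell(v^{-1}w)$. Let $c$ be a Coxeter element (a conjugate of a product of all simple reflections in some order), $\mathrm{NC}=\mathrm{NC}(W)=\{w\in W: w\le c\}$, and let $\phi:\mathrm{NC}\to\mathrm{NC}$, $\phi(w)=w^{-1}c$, be the Kreweras map. Let $V$ be one of the following, $\Lambda=\Lambda(V)$ the lattice of linear subspaces of $V$, and $f:\mathrm{NC}\to\Lambda$ the following map. * (Real case.) $V=V_{\mathbb R}$ is the space of the geometric representation of $W$, with basis the simple roots, and $f(w)=\mathrm{mov}(w)=\mathrm{im}(w-\mathrm{id})$. * (Case $p$.) $W$ is the Weyl group of a crystallographic root system with root lattice $V_{\mathbb Z}\subseteq V_{\mathbb R}$, $p$ is a prime, $V=V_{\mathbb Z}\otimes\mathbb F_p$, and $f(w)$ is the image of $\mathrm{mov}(w)\cap V_{\mathbb Z}$ in $V$. For $t\in T$ let $\alpha_t\in V$ be the (image of the) positive root of $t$. For a bilinear form $b$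 on $V$ and $U\subseteq V$ put $U^{\perp_b}=\{v\in V: b(u,v)=0\ \text{for all } u\in U\}$. A lattice skew-automorphism is a lattice automorphism or a lattice anti-automorphism (order-reversing bijection with order-reversing inverse). A map $\Psi:\Lambda\to\Lambda$ extends $\psi:\mathrm{NC}\to\mathrm{NC}$ if $\Psi\circ f=f\circ\psi$. **Criterion.** In the real case, or in case $p$ if $p$ is compatible with the root system (every basis of $V_{\mathbb R}$ that consists of roots is mapped to a basis of $V$), let $b$ be a non-degenerate bilinear form on $V$ such that $b(\alpha_s,\alpha_t)=0$ for all reflections $s\ne t$ with $st\in\mathrm{NC}$. Then $\phi$ is a lattice anti-automorphism of $\mathrm{NC}$, and $U\mapsto U^{\perp_b}$ is a lattice anti-automorphism of $\Lambda$ that extends $\phi$. **Theorem.** Let $W$ be of type $A_n$ ($n\ge1$), $B_n$ ($n\ge2$) or $D_n$ ($n\ge3$). Consider the real case, and case $p$ for the root systems $\{\pm(e_i-e_j)\}$ of type $A_n$ (any prime $p$), $\{\pm e_i\pm e_j,\pm e_i\}$ of type $B_n$ and $\{\pm e_i\pm e_j\}$ of type $D_n$ (any prime $p\neq2$). 1.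 Let $c=lr$ with $l^2=r^2=1$, let $\phi_l:\mathrm{NC}\to\mathrm{NC}$, $\phi_l(w)=lw^{-1}l$, and let $\hat{\mathcal D}=\langle\phi_l,\phi\rangle$. Every element of $\hat{\mathcal D}$ is a lattice automorphism of $\mathrm{NC}$ that extends to a lattice automorphism of $\Lambda$, or a lattice anti-automorphism of $\mathrm{NC}$ that extends to the lattice anti-automorphism $U\mapsto U^{\perp_b}$ of $\Lambda$ for some non-degenerate bilinear form $b$ on $V$. 2. Let $\alpha_1,\dots,\alpha_n$ be the simple roots $\alpha_i=e_i-e_{i+1}$ for $i<n$, and $\alpha_n=e_n$ in types $A_n$ (with the convention $e_{n+1}=0$) and $B_n$, $\alpha_n=e_{n-1}+e_n$ in type $D_n$. Then $e_1,\dots,e_n$ is a basis of $V$; let $c=s_{\alpha_1}\cdots s_{\alpha_n}$. Define bilinear forms on $V$ by $$b_A(e_i,e_j)=\begin{cases}1& i\le j\\0& i>j\end{cases},\qquad b_B(e_i,e_j)=\begin{cases}1& i\le j\\-1& i>j\end{cases},\qquad b_D(e_i,e_j)=\begin{cases}1& i\le j<n\ \text{or}\ i=j=n\\-1& j<i<n\\0&\text{otherwise.}\end{cases}$$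 For $X\in\{A,B,D\}$ the type of $W$, the form $b_X$ is non-degenerate, $b_X(\alpha_s,\alpha_t)=0$ for all reflections $s\neq t$ with $st\in\mathrm{NC}$, and $U\mapsto U^{\perp_{b_X}}$ is a lattice anti-automorphism of $\Lambda$ that extends $\phi$. -/

import Mathlib

/-! # Non-crossing partitions of finite Coxeter groups and their embeddings into lattices of
linear subspaces -/

namespace NonCrossing

/-! ## Lattice skew-automorphisms

A bijection between lattices that preserves (reverses) the order in both directions is the same
thing as a lattice automorphism (anti-automorphism). -/

/-- `g` is a lattice automorphism. -/
def IsLatticeAut {P : Type*} [LE P] (g : P → P) : Prop :=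
  Function.Bijective g ∧ ∀ x y, g x ≤ g y ↔ x ≤ y

/-- `g` is a lattice anti-automorphism. -/
def IsLatticeAntiAut {P : Type*} [LE P] (g : P → P) : Prop :=
  Function.Bijective g ∧ ∀ x y, g x ≤ g y ↔ y ≤ x

/-- For a map `f` from a poset `P` to the lattice of linear subspaces of `V`, the self-map `g` of
`P` is a lattice anti-automorphism, and the map `U ↦ U^⊥ = {v | b(u, v) = 0 for all u ∈ U}` is a
lattice anti-automorphism that extends it. -/
def ComplementExtends {P : Type*} [LE P] {K V : Type*} [Field K] [AddCommGroup V] [Module K V]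
    (f : P → Submodule K V) (g : P → P) (b : LinearMap.BilinForm K V) : Prop :=
  IsLatticeAntiAut g ∧ IsLatticeAntiAut (fun U : Submodule K V => b.orthogonal U) ∧
    ∀ w, b.orthogonal (f w) = f (g w)

/-- `g` is a lattice automorphism of `P` that extends to a lattice automorphism of the lattice of
linear subspaces of `V`, or a lattice anti-automorphism of `P` that extends to the map
`U ↦ U^⊥` of some non-degenerate bilinear form, which is a lattice anti-automorphism. -/
def SkewExtends {P : Type*} [LE P] {K V : Type*} [Field K] [AddCommGroup V] [Module K V]
    (f : P → Submodule K V) (g : P → P) : Prop :=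
  (IsLatticeAut g ∧
    ∃ Ψ : Submodule K V → Submodule K V, IsLatticeAut Ψ ∧ ∀ w, Ψ (f w) = f (g w)) ∨
  ∃ b : LinearMap.BilinForm K V, b.Nondegenerate ∧ ComplementExtends f g b

/-! ## The geometric representation

The space `V` has the simple roots as a basis; it is `B → ℝ` in the coordinates of this basis. -/

/-- `A` is a Cartan matrix for the Coxeter matrix `M`: there are simple roots `α i` and coroots
`α i ^∨` with `A i j = ⟨α i, α j ^∨⟩` whose reflections have the orders prescribed by `M`. The
choice `A i j = - 2 cos (π / M i j)` gives the usual normalization, where all roots have the same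
length; an integral `A` gives a crystallographic root system. -/
structure IsCartan {B : Type*} (M : CoxeterMatrix B) (A : Matrix B B ℝ) : Prop where
  diag : ∀ i, A i i = 2
  nonpos : ∀ i j, i ≠ j → A i j ≤ 0
  zero : ∀ i j, A i j = 0 → A j i = 0
  prod : ∀ i j, i ≠ j → M i j ≠ 0 → A i j * A j i = 4 * Real.cos (Real.pi / M i j) ^ 2

/-- The simple root `α i`. -/
def simpleRoot {B : Type*} [DecidableEq B] (i : B) : B → ℝ := Pi.single i 1

/-- The simple coroot `v ↦ ⟨v, α j ^∨⟩ = ∑ i, v i * A i j`. -/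
noncomputable def coroot {B : Type*} [Fintype B] (A : Matrix B B ℝ) (j : B) :
    Module.Dual ℝ (B → ℝ) :=
  LinearMap.proj j ∘ₗ A.vecMulLinear

theorem coroot_simpleRoot {B : Type*} [Fintype B] [DecidableEq B] (A : Matrix B B ℝ) (i j : B) :
    coroot A j (simpleRoot i) = A i j := by
  simp [coroot, simpleRoot]

theorem coroot_self {B : Type*} [Fintype B] [DecidableEq B] {M : CoxeterMatrix B}
    {A : Matrix B B ℝ} (hA : IsCartan M A) (j : B) : coroot A j (simpleRoot j) = 2 := by
  rw [coroot_simpleRoot, hA.diag]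

/-- The simple reflection `v ↦ v - ⟨v, α j ^∨⟩ α j`. -/
noncomputable def refl {B : Type*} [Fintype B] [DecidableEq B] {M : CoxeterMatrix B}
    {A : Matrix B B ℝ} (hA : IsCartan M A) (j : B) : (B → ℝ) ≃ₗ[ℝ] (B → ℝ) :=
  Module.reflection (coroot_self hA j)

theorem refl_isLiftable {B : Type*} [Fintype B] [DecidableEq B] {M : CoxeterMatrix B}
    {A : Matrix B B ℝ} (hA : IsCartan M A) : M.IsLiftable (refl hA) := by
  intro i j
  by_cases hij : i = j
  · subst hij
    rw [M.diagonal, pow_one]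
    ext1 v
    exact Module.involutive_reflection (coroot_self hA i) v
  by_cases hm : M i j = 0
  · rw [hm, pow_zero]
  have hm1 : M i j ≠ 1 := M.off_diagonal i j hij
  have hp := hA.prod i j hij hm
  ext1 z
  by_cases hm2 : M i j = 2
  · have h0 : A i j * A j i = 0 := by rw [hp, hm2]; simp
    have h1 : A i j = 0 ∧ A j i = 0 := by
      rcases mul_eq_zero.1 h0 with h | h
      · exact ⟨h, hA.zero _ _ h⟩
      · exact ⟨hA.zero _ _ h, h⟩
    rw [hm2]
    simp only [refl, pow_two, LinearEquiv.mul_apply, Module.reflection_apply, map_sub, map_smul,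
      coroot_simpleRoot, hA.diag, h1.1, h1.2, LinearEquiv.coe_one, id_eq]
    module
  have hm3 : 3 ≤ M i j := by omega
  set m := M i j with hmdef
  have hmpos : (0 : ℝ) < m := by positivity
  set φ : ℝ := 2 * (Real.pi / m) with hφ
  have ht : coroot A i (simpleRoot j) * coroot A j (simpleRoot i) - 2 = 2 * Real.cos φ := by
    rw [coroot_simpleRoot, coroot_simpleRoot, mul_comm, hp, hφ, Real.cos_two_mul]; ring
  have hs : Real.sin φ ≠ 0 := by
    apply ne_of_gt
    apply Real.sin_pos_of_pos_of_lt_pi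
    · have := Real.pi_pos; positivity
    · rw [hφ, ← mul_div_assoc, div_lt_iff₀ hmpos]
      have : (3 : ℝ) ≤ m := by exact_mod_cast hm3
      nlinarith [Real.pi_pos]
  have hS : ∀ k : ℤ, (Polynomial.Chebyshev.S ℝ k).eval (2 * Real.cos φ) = Real.sin ((k + 1) * φ) / Real.sin φ := by
    intro k
    rw [eq_div_iff hs, Polynomial.Chebyshev.S_two_mul_real_cos]
  have key := Module.reflection_mul_reflection_pow_apply (coroot_self hA i) (coroot_self hA j) m z
  rw [ht] at key
  change ((Module.reflection (coroot_self hA i) * Module.reflection (coroot_self hA j)) ^ m) z = z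
  rw [key]
  rcases Nat.even_or_odd' m with ⟨k, hk | hk⟩
  · have e1 : ((m : ℤ) - 2) / 2 = (k : ℤ) - 1 := by omega
    have e2 : ((m : ℤ) - 1) / 2 = (k : ℤ) - 1 := by omega
    have h0 : (Polynomial.Chebyshev.S ℝ ((k : ℤ) - 1)).eval (2 * Real.cos φ) = 0 := by
      rw [hS]
      have : (((k : ℤ) - 1 : ℤ) + 1 : ℝ) * φ = Real.pi := by
        rw [hφ]; push_cast
        have : (m : ℝ) = 2 * k := by exact_mod_cast hk
        rw [this] at hmpos ⊢
        have hk0 : (k : ℝ) ≠ 0 := by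
          intro h
          simp [h] at hmpos
        field_simp
        ring
      rw [this]; simp
    rw [e1, e2, h0]; simp
  · have e1 : ((m : ℤ) - 2) / 2 = (k : ℤ) - 1 := by omega
    have e2 : ((m : ℤ) - 1) / 2 = (k : ℤ) := by omega
    have e3 : ((m : ℤ) - 3) / 2 = (k : ℤ) - 1 := by omega
    have e4 : ((m : ℤ)) / 2 = (k : ℤ) := by omega
    have h0 : (Polynomial.Chebyshev.S ℝ (k : ℤ)).eval (2 * Real.cos φ) + (Polynomial.Chebyshev.S ℝ ((k : ℤ) - 1)).eval (2 * Real.cos φ)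
        = 0 := by
      rw [hS, hS, ← add_div]
      have : (k : ℝ) * φ = 2 * Real.pi - (k + 1) * φ := by
        rw [hφ]
        have : (m : ℝ) = 2 * k + 1 := by exact_mod_cast hk
        rw [this] at hmpos ⊢
        field_simp
        ring
      push_cast
      rw [sub_add_cancel, this, Real.sin_two_pi_sub]
      simp
    rw [e1, e2, e3, e4, h0]; simp

/-- The geometric representation of a Coxeter group: the simple reflections act by `refl`. -/
noncomputable def geomRep {B W : Type*} [Fintype B] [DecidableEq B] [Group W]
    {M : CoxeterMatrix B} {A : Matrix B B ℝ} (cs : CoxeterSystem M W) (hA : IsCartan M A) :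
    W →* ((B → ℝ) ≃ₗ[ℝ] (B → ℝ)) :=
  cs.lift ⟨refl hA, refl_isLiftable hA⟩

/-- The moved space `mov(w)`, the image of `w - id`. -/
noncomputable def mov {B W : Type*} [Fintype B] [DecidableEq B] [Group W]
    {M : CoxeterMatrix B} {A : Matrix B B ℝ} (cs : CoxeterSystem M W) (hA : IsCartan M A)
    (w : W) : Submodule ℝ (B → ℝ) :=
  LinearMap.range ((geomRep cs hA w : (B → ℝ) →ₗ[ℝ] (B → ℝ)) - LinearMap.id)

/-- The reduction modulo `p` of the intersection of `U` with the root lattice, which consists of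
the vectors with integral coordinates in the basis of simple roots. -/
def reduceSubspace {B : Type*} (p : ℕ) (U : Submodule ℝ (B → ℝ)) :
    Submodule (ZMod p) (B → ZMod p) :=
  Submodule.span (ZMod p)
    {v | ∃ z : B → ℤ, (fun i => (z i : ℝ)) ∈ U ∧ v = fun i => (z i : ZMod p)}

/-- The `p`-moved space of `w`. -/
noncomputable def movP {B W : Type*} [Fintype B] [DecidableEq B] [Group W]
    {M : CoxeterMatrix B} {A : Matrix B B ℝ} (cs : CoxeterSystem M W) (hA : IsCartan M A)
    (p : ℕ) (w : W) : Submodule (ZMod p) (B → ZMod p) :=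
  reduceSubspace p (mov cs hA w)

/-- `v` is a root of the reflection `t`: for some `u` and some simple reflection `s` with root
`α`, one has `t = u s u⁻¹` and `v = u α`. This allows the positive root of `t` and its negative. -/
def IsRootOf {B W : Type*} [Fintype B] [DecidableEq B] [Group W]
    {M : CoxeterMatrix B} {A : Matrix B B ℝ} (cs : CoxeterSystem M W) (hA : IsCartan M A)
    (t : W) (v : B → ℝ) : Prop :=
  ∃ u i, t = u * cs.simple i * u⁻¹ ∧ v = geomRep cs hA u (simpleRoot i)

/-- The integral vector `z` is a root of the reflection `t`. -/
def IsIntRootOf {B W : Type*} [Fintype B] [DecidableEq B] [Group W]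
    {M : CoxeterMatrix B} {A : Matrix B B ℝ} (cs : CoxeterSystem M W) (hA : IsCartan M A)
    (t : W) (z : B → ℤ) : Prop :=
  IsRootOf cs hA t (fun i => (z i : ℝ))

/-- The prime `p` is compatible with the root system: every basis of `V` that consists of roots
is mapped to a basis by reduction modulo `p`. -/
def Compatible {B W : Type*} [Fintype B] [DecidableEq B] [Group W]
    {M : CoxeterMatrix B} {A : Matrix B B ℝ} (cs : CoxeterSystem M W) (hA : IsCartan M A)
    (p : ℕ) : Prop :=
  ∀ z : B → (B → ℤ), (∀ k, ∃ t, IsIntRootOf cs hA t (z k)) →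
    LinearIndependent ℝ (fun k i => (z k i : ℝ)) →
    LinearIndependent (ZMod p) (fun k i => (z k i : ZMod p))

/-! ## Absolute order and non-crossing partitions -/

/-- The absolute (reflection) length of `w`: the least number of reflections with product `w`. -/
noncomputable def absLength {B W : Type*} [Group W] {M : CoxeterMatrix B}
    (cs : CoxeterSystem M W) (w : W) : ℕ :=
  sInf {k | ∃ ts : List W, ts.length = k ∧ (∀ t ∈ ts, cs.IsReflection t) ∧ ts.prod = w}

/-- The absolute order. -/
def AbsLE {B W : Type*} [Group W] {M : CoxeterMatrix B} (cs : CoxeterSystem M W) (v w : W) :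
    Prop :=
  absLength cs w = absLength cs v + absLength cs (v⁻¹ * w)

/-- A Coxeter element: a conjugate of a product of all simple reflections in some order. -/
def IsCoxeterElement {B W : Type*} [Group W] {M : CoxeterMatrix B} (cs : CoxeterSystem M W)
    (c : W) : Prop :=
  ∃ l : List B, l.Nodup ∧ (∀ i, i ∈ l) ∧ ∃ w, c = w * cs.wordProd l * w⁻¹

/-- The non-crossing partitions `NC(W)` with respect to `c`. -/
def NC {B W : Type*} [Group W] {M : CoxeterMatrix B} (cs : CoxeterSystem M W) (c : W) : Type _ :=
  {w : W // AbsLE cs w c}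

/-- The order on `NC(W)` is the absolute order. -/
instance {B W : Type*} [Group W] {M : CoxeterMatrix B} (cs : CoxeterSystem M W) (c : W) :
    LE (NC cs c) :=
  ⟨fun v w => AbsLE cs v.1 w.1⟩

/-- The reflection `s` subordinates the reflection `t`. -/
def Subordinates {B W : Type*} [Group W] {M : CoxeterMatrix B} (cs : CoxeterSystem M W) (c : W)
    (s t : W) : Prop :=
  cs.IsReflection s ∧ cs.IsReflection t ∧ s ≠ t ∧ AbsLE cs (s * t) c

theorem absLength_conj_le {B W : Type*} [Group W] {M : CoxeterMatrix B}
    (cs : CoxeterSystem M W) (u w : W) : absLength cs (u * w * u⁻¹) ≤ absLength cs w := by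
  have hne : {k | ∃ ts : List W, ts.length = k ∧ (∀ t ∈ ts, cs.IsReflection t) ∧
      ts.prod = w}.Nonempty := by
    obtain ⟨l, hl⟩ := cs.wordProd_surjective w
    refine ⟨_, l.map cs.simple, rfl, ?_, hl⟩
    intro t ht
    obtain ⟨i, -, rfl⟩ := List.mem_map.1 ht
    exact cs.isReflection_simple i
  obtain ⟨ts, h1, h2, h3⟩ := Nat.sInf_mem hne
  refine Nat.sInf_le ⟨ts.map (MulAut.conj u), ?_, ?_, ?_⟩
  · rw [List.length_map, h1, absLength]
  · intro t ht
    obtain ⟨t₀, h, rfl⟩ := List.mem_map.1 ht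
    exact (h2 t₀ h).conj u
  · rw [← map_list_prod, h3, MulAut.conj_apply]

theorem absLength_conj {B W : Type*} [Group W] {M : CoxeterMatrix B}
    (cs : CoxeterSystem M W) (u w : W) : absLength cs (u * w * u⁻¹) = absLength cs w := by
  apply le_antisymm (absLength_conj_le cs u w)
  have h := absLength_conj_le cs u⁻¹ (u * w * u⁻¹)
  rwa [show u⁻¹ * (u * w * u⁻¹) * u⁻¹⁻¹ = w by group] at h

theorem absLength_inv {B W : Type*} [Group W] {M : CoxeterMatrix B}
    (cs : CoxeterSystem M W) (w : W) : absLength cs w⁻¹ = absLength cs w := by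
  have key : ∀ w : W, ∀ k, (∃ ts : List W, ts.length = k ∧ (∀ t ∈ ts, cs.IsReflection t) ∧
      ts.prod = w) → ∃ ts : List W, ts.length = k ∧ (∀ t ∈ ts, cs.IsReflection t) ∧
      ts.prod = w⁻¹ := by
    rintro w k ⟨ts, h1, h2, h3⟩
    refine ⟨(ts.map (fun x => x⁻¹)).reverse, by simp [h1], ?_, ?_⟩
    · intro t ht
      rw [List.mem_reverse, List.mem_map] at ht
      obtain ⟨t₀, h, rfl⟩ := ht
      exact (h2 t₀ h).isReflection_inv
    · rw [← List.prod_inv_reverse, h3]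
  unfold absLength
  congr 1
  ext k
  exact ⟨fun h => by simpa using key _ k h, key w k⟩

theorem absLE_kreweras {B W : Type*} [Group W] {M : CoxeterMatrix B}
    {cs : CoxeterSystem M W} {c w : W} (h : AbsLE cs w c) : AbsLE cs (w⁻¹ * c) c := by
  unfold AbsLE at h ⊢
  rw [show (w⁻¹ * c)⁻¹ * c = c⁻¹ * w * c⁻¹⁻¹ by group, absLength_conj, h, add_comm]

theorem absLE_kreweras_symm {B W : Type*} [Group W] {M : CoxeterMatrix B}
    {cs : CoxeterSystem M W} {c w : W} (h : AbsLE cs w c) : AbsLE cs (c * w⁻¹) c := by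
  unfold AbsLE at h ⊢
  rw [show (c * w⁻¹)⁻¹ * c = w by group, h, add_comm,
    show c * w⁻¹ = w * (w⁻¹ * c) * w⁻¹ by group, absLength_conj]

/-- The Kreweras map `φ : w ↦ w⁻¹ c`. -/
def kreweras {B W : Type*} [Group W] {M : CoxeterMatrix B} (cs : CoxeterSystem M W) (c : W) :
    Equiv.Perm (NC cs c) where
  toFun w := ⟨w.1⁻¹ * c, absLE_kreweras w.2⟩
  invFun w := ⟨c * w.1⁻¹, absLE_kreweras_symm w.2⟩
  left_inv w := Subtype.ext (by simp)
  right_inv w := Subtype.ext (by simp)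

/-- A bipartition `c = l r` of `c` into two elements with `l² = r² = 1`. -/
structure IsBipartition {W : Type*} [Group W] (c l r : W) : Prop where
  eq : c = l * r
  left : l * l = 1
  right : r * r = 1

theorem absLE_phiLeft {B W : Type*} [Group W] {M : CoxeterMatrix B} {cs : CoxeterSystem M W}
    {c l r w : W} (hb : IsBipartition c l r) (h : AbsLE cs w c) :
    AbsLE cs (l * w⁻¹ * l) c := by
  have hl : l⁻¹ = l := inv_eq_of_mul_eq_one_left hb.left
  have hr : r⁻¹ = r := inv_eq_of_mul_eq_one_left hb.right
  have e1 : absLength cs (l * w⁻¹ * l) = absLength cs w := by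
    conv_lhs => rw [show l * w⁻¹ * l = l * w⁻¹ * l⁻¹ by rw [hl]]
    rw [absLength_conj, absLength_inv]
  have e2 : absLength cs ((l * w⁻¹ * l)⁻¹ * c) = absLength cs (w⁻¹ * c) := by
    have : (l * w⁻¹ * l)⁻¹ * c = (l * w) * (w⁻¹ * c)⁻¹ * (l * w)⁻¹ := by
      have hc : c⁻¹ = r * l := by rw [hb.eq, mul_inv_rev, hl, hr]
      have hc2 : l * c = r := by rw [hb.eq, ← mul_assoc, hb.left, one_mul]
      simp only [mul_inv_rev, inv_inv, hl, hc]
      calc l * (w * l) * c = l * w * (l * c) := by group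
        _ = l * w * r := by rw [hc2]
        _ = l * w * r * (l * l) := by rw [hb.left, mul_one]
        _ = l * w * (r * l * w) * (w⁻¹ * l) := by group
    rw [this, absLength_conj, absLength_inv]
  unfold AbsLE at h ⊢
  rw [e1, e2, h]

/-- The map `φ_l : w ↦ l w⁻¹ l`. -/
def phiLeft {B W : Type*} [Group W] {M : CoxeterMatrix B} (cs : CoxeterSystem M W) {c l r : W}
    (hb : IsBipartition c l r) : Equiv.Perm (NC cs c) where
  toFun w := ⟨l * w.1⁻¹ * l, absLE_phiLeft hb w.2⟩
  invFun w := ⟨l * w.1⁻¹ * l, absLE_phiLeft hb w.2⟩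
  left_inv w := Subtype.ext (by
    have hl : l⁻¹ = l := inv_eq_of_mul_eq_one_left hb.left
    simp only [mul_inv_rev, inv_inv, hl]
    calc l * (l * (w.1 * l)) * l = (l * l) * w.1 * (l * l) := by group
      _ = w.1 := by rw [hb.left, one_mul, mul_one])
  right_inv w := Subtype.ext (by
    have hl : l⁻¹ = l := inv_eq_of_mul_eq_one_left hb.left
    simp only [mul_inv_rev, inv_inv, hl]
    calc l * (l * (w.1 * l)) * l = (l * l) * w.1 * (l * l) := by group
      _ = w.1 := by rw [hb.left, one_mul, mul_one])

/-- The dihedral group generated by `φ_l` and the Kreweras map. -/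
def dihedral {B W : Type*} [Group W] {M : CoxeterMatrix B} (cs : CoxeterSystem M W) {c l r : W}
    (hb : IsBipartition c l r) : Subgroup (Equiv.Perm (NC cs c)) :=
  Subgroup.closure {phiLeft cs hb, kreweras cs c}

/-! ## The classical types -/

/-- The classical types. -/
inductive ClassicalType
  | A
  | B
  | D

namespace ClassicalType

/-- The ranks of the groups of a type are the integers that are at least `minRank`. -/
def minRank : ClassicalType → ℕ
  | A => 1
  | B => 2
  | D => 3

/-- The Cartan matrix of the root system. For type `A` the roots are `± (e i - e j)`, for type `B`
they are `± e i ± e j` and `± e i`, for type `D` they are `± e i ± e j`. -/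
def cartan (X : ClassicalType) (n : ℕ) : Matrix (Fin n) (Fin n) ℤ :=
  match X with
  | A => CartanMatrix.A n
  | B => CartanMatrix.B n
  | D => CartanMatrix.D n

/-- The Coxeter matrix of type `D`: the diagram is the path on all nodes but the last one, and the
last node is joined to the third last one only. The matrix `CoxeterMatrix.D` of the library is not
used, since it joins the last two nodes as well. -/
def coxeterMatrixD (n : ℕ) : CoxeterMatrix (Fin n) where
  M := Matrix.of fun i j => if i = j then 1 else if CartanMatrix.D n i j = 0 then 2 else 3
  isSymm := by
    ext i j
    have h : CartanMatrix.D n j i = CartanMatrix.D n i j :=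
      congrFun (congrFun (CartanMatrix.D_isSymm n) i) j
    simp only [Matrix.transpose_apply, Matrix.of_apply, h, eq_comm]
  diagonal := by simp
  off_diagonal := by
    intro i j hij
    simp only [Matrix.of_apply, if_neg hij]
    split_ifs <;> simp

/-- The Coxeter matrix of type `X` and rank `n`. -/
def coxeterMatrix (X : ClassicalType) (n : ℕ) : CoxeterMatrix (Fin n) :=
  match X with
  | A => CoxeterMatrix.A n
  | B => CoxeterMatrix.B n
  | D => coxeterMatrixD n

theorem isCartan (X : ClassicalType) (n : ℕ) :
    IsCartan (X.coxeterMatrix n) ((X.cartan n).map (Int.cast : ℤ → ℝ)) := by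
  have c4 : 4 * Real.cos (Real.pi / 4) ^ 2 = 2 := by
    rw [Real.cos_pi_div_four, div_pow, Real.sq_sqrt (by norm_num)]
    norm_num
  have c3 : 4 * Real.cos (Real.pi / 3) ^ 2 = 1 := by
    rw [Real.cos_pi_div_three]
    norm_num
  have c2 : 4 * Real.cos (Real.pi / 2) ^ 2 = 0 := by
    rw [Real.cos_pi_div_two]
    norm_num
  have cast2 : ((2 : ℕ) : ℝ) = 2 := by norm_num
  have cast3 : ((3 : ℕ) : ℝ) = 3 := by norm_num
  have cast4 : ((4 : ℕ) : ℝ) = 4 := by norm_num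
  cases X
  · constructor
    · intro i
      simp [cartan, CartanMatrix.A]
    · intro i j hij
      simp only [cartan, CartanMatrix.A, Matrix.map_apply, Matrix.of_apply, if_neg hij]
      split_ifs <;> norm_num
    · intro i j
      simp only [cartan, CartanMatrix.A, Matrix.map_apply, Matrix.of_apply, eq_comm (a := j),
        or_comm (a := j.val + 1 = i.val)]
      exact id
    · intro i j hij _
      simp only [cartan, coxeterMatrix, CoxeterMatrix.A, CartanMatrix.A, Matrix.map_apply,
        Matrix.of_apply, if_neg hij, if_neg (Ne.symm hij), or_comm (a := j.val + 1 = i.val)]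
      split_ifs
      · rw [cast3, c3]; norm_num
      · rw [cast2, c2]; norm_num
  · constructor
    · intro i
      simp [cartan, CartanMatrix.B]
    · intro i j hij
      simp only [cartan, CartanMatrix.B, Matrix.map_apply, Matrix.of_apply, if_neg hij]
      split_ifs <;> norm_num
    · intro i j
      simp only [cartan, CartanMatrix.B, Matrix.map_apply, Matrix.of_apply, Fin.ext_iff]
      split_ifs <;> first | omega | norm_num
    · intro i j hij _
      simp only [cartan, coxeterMatrix, CoxeterMatrix.B, CartanMatrix.B, Matrix.map_apply,
        Matrix.of_apply, if_neg hij, if_neg (Ne.symm hij)]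
      split_ifs <;> first
        | (exfalso; omega)
        | (rw [cast4, c4]; norm_num)
        | (rw [cast3, c3]; norm_num)
        | (rw [cast2, c2]; norm_num)
  · have hsymm : ∀ i j, CartanMatrix.D n j i = CartanMatrix.D n i j := fun i j =>
      congrFun (congrFun (CartanMatrix.D_isSymm n) i) j
    have hval : ∀ i j, i ≠ j → CartanMatrix.D n i j = 0 ∨ CartanMatrix.D n i j = -1 := by
      intro i j hij
      simp only [CartanMatrix.D, Matrix.of_apply, if_neg hij]
      split_ifs <;> simp
    constructor
    · intro i
      simp [cartan, CartanMatrix.D]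
    · intro i j hij
      simp only [cartan, Matrix.map_apply]
      rcases hval i j hij with h | h <;> rw [h] <;> norm_num
    · intro i j h
      simpa only [cartan, Matrix.map_apply, hsymm i j] using h
    · intro i j hij _
      have hM : coxeterMatrixD n i j = if CartanMatrix.D n i j = 0 then 2 else 3 := if_neg hij
      simp only [cartan, coxeterMatrix, Matrix.map_apply, hsymm i j, hM]
      rcases hval i j hij with h | h <;> rw [h]
      · simp
      · rw [if_neg (by norm_num), cast3, c3]; norm_num

/-- The coordinates of the `i`-th simple root in the basis `e`. The simple roots are
`e i - e (i + 1)` for `i + 1 < n`; the last one is `e n` for the types `A` and `B` and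
`e (n - 1) + e n` for type `D`. For type `A` this is the convention `e (n + 1) = 0`. -/
def simpleVec (X : ClassicalType) (n : ℕ) (K : Type*) [Ring K] (i : Fin n) : Fin n → K :=
  fun k =>
    match X with
    | A => if k = i then 1 else if k.val = i.val + 1 then -1 else 0
    | B => if k = i then 1 else if k.val = i.val + 1 then -1 else 0
    | D =>
      if i.val + 1 = n then (if k = i ∨ k.val + 1 = i.val then 1 else 0)
      else if k = i then 1 else if k.val = i.val + 1 then -1 else 0

/-- The values `b_X (e i, e j)` of the bilinear forms `b_A`, `b_B` and `b_D`. -/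
def gram (X : ClassicalType) (n : ℕ) (K : Type*) [Ring K] : Matrix (Fin n) (Fin n) K :=
  Matrix.of fun i j =>
    match X with
    | A => if i ≤ j then 1 else 0
    | B => if i ≤ j then 1 else -1
    | D =>
      if (i ≤ j ∧ j.val + 1 < n) ∨ (i = j ∧ j.val + 1 = n) then 1
      else if j < i ∧ i.val + 1 < n then -1 else 0

/-- The bilinear form `b_X`, in the coordinates of the basis of simple roots. -/
noncomputable def form (X : ClassicalType) (n : ℕ) (K : Type*) [Field K] :
    LinearMap.BilinForm K (Fin n → K) :=
  (Matrix.toBilin' (X.gram n K)).comp (Fintype.linearCombination K (X.simpleVec n K))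
    (Fintype.linearCombination K (X.simpleVec n K))

end ClassicalType

end NonCrossing

namespace NonCrossing

/-! ## Absolute length -/

section AbsLength

variable {B W : Type*} [Group W] {M : CoxeterMatrix B} (cs : CoxeterSystem M W)

/-! Write n for the rank. A Coxeter element c fixes no nonzero vector, so mov(c) = V
(`mov_coxeterElement`). Since dim mov(w) ≤ ℓ(w), it follows that ℓ(c) = n. For w ≤ c, the chain n ≤
dim mov(w) + dim mov(w⁻¹c) ≤ ℓ(w) + ℓ(w⁻¹c) = n consists of equalities, so mov(w) is spanned by the
roots of any reduced factorization of w. Concatenating reduced factorizations of w and w⁻¹c gives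
one of c, and conjugating reflections to the front shows t t' ≤ c whenever t precedes t' in it
(`subordinates_of_mem`). So the hypothesis on b makes f(w) and f(w⁻¹c) orthogonal, and a dimension
count gives f(w)^⊥ = f(w⁻¹c). Modulo p the same argument works once the n roots of the factorization
stay independent: by Cramer's rule f(w) is then spanned by the reduced roots
(`intCast_mem_span_of_mem_span`, `movP_eq_span`).

A form as in the criterion is the Euler form b((1 - c)x, y) = (x, y), where (·,·) is W-invariant. If
c = uv with additive dimensions of moved spaces, then 1 - c maps Fix(v) onto mov(u), and invariance
under v gives b(mov(u), mov(v)) = 0 (`bilin_mov_mov_eq_zero`). Moreover 2b(x, x) = (x, x). Hence the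
roots of a reduced factorization of c have a triangular Gram matrix with half squared lengths on the
diagonal. When b is integral on the root lattice, this matrix can be reduced modulo p. If p divides
no half squared length, it yields both non-degeneracy of b and independence of the roots, so no
separate compatibility argument is needed in the classical types. For c = s_1 ⋯ s_n the Euler form
is triangular on the simple roots (`bilin_sub_wordProd`), and b_X is identified with it by its
values there (`form_eq_toBilin'`).

Finally, mov(l w⁻¹ l) = l mov(w), so φ_l is induced by a linear map. Maps induced by linear
automorphisms or by complements of forms are closed under products and inverses
(`LinearlyExtends.mul`, `LinearlyExtends.inv`), so the two generators suffice. -/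

theorem exists_reflections_prod_eq (w : W) :
    ∃ ts : List W, ts.length = absLength cs w ∧ (∀ t ∈ ts, cs.IsReflection t) ∧ ts.prod = w := by
  have hne : {k | ∃ ts : List W, ts.length = k ∧ (∀ t ∈ ts, cs.IsReflection t) ∧
      ts.prod = w}.Nonempty := by
    obtain ⟨l, hl⟩ := cs.wordProd_surjective w
    refine ⟨_, l.map cs.simple, rfl, ?_, hl⟩
    intro t ht
    obtain ⟨i, -, rfl⟩ := List.mem_map.1 ht
    exact cs.isReflection_simple i
  exact Nat.sInf_mem hne

theorem absLength_prod_le {ts : List W} (h : ∀ t ∈ ts, cs.IsReflection t) :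
    absLength cs ts.prod ≤ ts.length :=
  Nat.sInf_le ⟨ts, rfl, h, rfl⟩

theorem absLength_mul_le (u v : W) :
    absLength cs (u * v) ≤ absLength cs u + absLength cs v := by
  obtain ⟨L, h1, h2, h3⟩ := exists_reflections_prod_eq cs u
  obtain ⟨L', h1', h2', h3'⟩ := exists_reflections_prod_eq cs v
  have := absLength_prod_le cs (ts := L ++ L') (by
    intro t ht
    rcases List.mem_append.1 ht with h | h
    exacts [h2 t h, h2' t h])
  rwa [List.prod_append, h3, h3', List.length_append, h1, h1'] at this

theorem absLength_reflection_le {t : W} (ht : cs.IsReflection t) : absLength cs t ≤ 1 := by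
  simpa using absLength_prod_le cs (ts := [t]) (by simpa using ht)

theorem lengthParity_reflection {t : W} (ht : cs.IsReflection t) :
    cs.lengthParity t = Multiplicative.ofAdd 1 := by
  obtain ⟨u, i, rfl⟩ := ht
  rw [map_mul, map_mul, cs.lengthParity_simple, map_inv, mul_comm, inv_mul_cancel_left]

/-- The product of two distinct reflections has absolute length two. -/
theorem absLength_mul_reflection {s t : W} (hs : cs.IsReflection s) (ht : cs.IsReflection t)
    (hst : s ≠ t) : absLength cs (s * t) = 2 := by
  have hle : absLength cs (s * t) ≤ 2 :=
    (absLength_mul_le cs s t).trans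
      (add_le_add (absLength_reflection_le cs hs) (absLength_reflection_le cs ht))
  obtain ⟨L, h1, h2, h3⟩ := exists_reflections_prod_eq cs (s * t)
  match L, h1 with
  | [], _ =>
    rw [List.prod_nil] at h3
    exact absurd ((eq_inv_of_mul_eq_one_left h3.symm).trans ht.inv) hst
  | [r], _ =>
    rw [List.prod_singleton] at h3
    -- Parity excludes a single reflection: reflections are odd, while s * t is even.
    have hr := lengthParity_reflection cs (h2 r (by simp))
    rw [h3, map_mul, lengthParity_reflection cs hs, lengthParity_reflection cs ht] at hr
    exact absurd hr (by decide)
  | _ :: _ :: _, h1 =>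
    simp only [List.length_cons] at h1
    omega

/-- On elements below c the length of w⁻¹c is ℓ(c) - ℓ(w), and (u⁻¹c)⁻¹(v⁻¹c) is conjugate to v⁻¹u,
so the two length identities say the same thing. -/
theorem isLatticeAntiAut_kreweras (c : W) : IsLatticeAntiAut (kreweras cs c) := by
  refine ⟨(kreweras cs c).bijective, ?_⟩
  rintro ⟨u, hu⟩ ⟨v, hv⟩
  change absLength cs (v⁻¹ * c) = absLength cs (u⁻¹ * c) + absLength cs ((u⁻¹ * c)⁻¹ * (v⁻¹ * c)) ↔
    absLength cs u = absLength cs v + absLength cs (v⁻¹ * u)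
  have e : absLength cs ((u⁻¹ * c)⁻¹ * (v⁻¹ * c)) = absLength cs (v⁻¹ * u) := by
    rw [← absLength_conj cs (v⁻¹ * c) ((u⁻¹ * c)⁻¹ * (v⁻¹ * c))]
    congr 1
    group
  unfold AbsLE at hu hv
  rw [e]
  omega

theorem isLatticeAut_phiLeft {c l r : W} (hb : IsBipartition c l r) :
    IsLatticeAut (phiLeft cs hb) := by
  refine ⟨(phiLeft cs hb).bijective, ?_⟩
  rintro ⟨u, hu⟩ ⟨v, hv⟩
  have hl : l⁻¹ = l := inv_eq_of_mul_eq_one_left hb.left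
  change absLength cs (l * v⁻¹ * l) =
      absLength cs (l * u⁻¹ * l) + absLength cs ((l * u⁻¹ * l)⁻¹ * (l * v⁻¹ * l)) ↔
    absLength cs v = absLength cs u + absLength cs (u⁻¹ * v)
  have e : ∀ w, absLength cs (l * w⁻¹ * l) = absLength cs w := by
    intro w
    conv_lhs => rw [show l * w⁻¹ * l = l * w⁻¹ * l⁻¹ by rw [hl]]
    rw [absLength_conj, absLength_inv]
  have e2 : (l * u⁻¹ * l)⁻¹ * (l * v⁻¹ * l) = l * (v * u⁻¹)⁻¹ * l := by
    simp only [mul_inv_rev, inv_inv, hl]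
    calc l * (u * l) * (l * v⁻¹ * l) = l * u * (l * l) * v⁻¹ * l := by group
      _ = l * (u * v⁻¹) * l := by rw [hb.left]; group
  rw [e2, e, e, e, ← absLength_conj cs u⁻¹ (v * u⁻¹)]
  simp [mul_assoc]

/-- A factor of a reduced factorization of `c`, followed by a later one. -/
theorem absLE_of_factorization {c t t' x y z : W} (h : c = x * t * y * t' * z)
    (ht : cs.IsReflection t) (ht' : cs.IsReflection t')
    (hl : absLength cs x + absLength cs y + absLength cs z + 2 ≤ absLength cs c) :
    AbsLE cs (t * t') c := by
  -- Pulling t and t' to the front only conjugates x and y, which preserves their lengths. The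
  -- cofactor of t t' is thus short enough to force additivity.
  have e : (t * t')⁻¹ * c = ((t' * t) * x * (t' * t)⁻¹) * (t' * y * t'⁻¹) * z := by
    rw [h, mul_inv_rev, mul_inv_rev, ht.inv, ht'.inv]
    simp only [← mul_assoc]
    rw [mul_assoc _ t' t', ht'.mul_self, mul_one]
  have h1 : absLength cs ((t * t')⁻¹ * c) ≤ absLength cs x + absLength cs y + absLength cs z := by
    rw [e]
    refine (absLength_mul_le cs _ _).trans (add_le_add_left ((absLength_mul_le cs _ _).trans ?_) _)
    rw [absLength_conj, absLength_conj]
  have h2 : absLength cs (t * t') ≤ 2 := (absLength_mul_le cs t t').trans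
    (add_le_add (absLength_reflection_le cs ht) (absLength_reflection_le cs ht'))
  have h3 := absLength_mul_le cs (t * t') ((t * t')⁻¹ * c)
  rw [mul_inv_cancel_left] at h3
  unfold AbsLE
  omega

end AbsLength

/-! ## Moved spaces -/

section Mov

variable {B W : Type*} [Fintype B] [DecidableEq B] [Group W] {M : CoxeterMatrix B}
  {A : Matrix B B ℝ} (cs : CoxeterSystem M W) (hA : IsCartan M A)

theorem geomRep_simple (i : B) : geomRep cs hA (cs.simple i) = refl hA i :=
  cs.lift_apply_simple _ i

theorem refl_apply (i : B) (v : B → ℝ) :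
    refl hA i v = v - coroot A i v • simpleRoot i :=
  Module.reflection_apply _ _

theorem geomRep_mul_apply (u v : W) (x : B → ℝ) :
    geomRep cs hA (u * v) x = geomRep cs hA u (geomRep cs hA v x) := by
  rw [map_mul]; rfl

theorem geomRep_inv_apply_self (u : W) (x : B → ℝ) :
    geomRep cs hA u⁻¹ (geomRep cs hA u x) = x := by
  rw [← geomRep_mul_apply, inv_mul_cancel, map_one]; rfl

theorem geomRep_apply_inv_self (u : W) (x : B → ℝ) :
    geomRep cs hA u (geomRep cs hA u⁻¹ x) = x := by
  rw [← geomRep_mul_apply, mul_inv_cancel, map_one]; rfl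

theorem mem_mov {w : W} {y : B → ℝ} :
    y ∈ mov cs hA w ↔ ∃ x, geomRep cs hA w x - x = y := Iff.rfl

theorem geomRep_sub_mem_mov (w : W) (x : B → ℝ) : geomRep cs hA w x - x ∈ mov cs hA w :=
  ⟨x, rfl⟩

theorem mov_one : mov cs hA 1 = ⊥ := by
  rw [eq_bot_iff]
  rintro _ ⟨x, rfl⟩
  simp

theorem mov_mul_le (u v : W) : mov cs hA (u * v) ≤ mov cs hA u ⊔ mov cs hA v := by
  rintro _ ⟨x, rfl⟩
  have : geomRep cs hA (u * v) x - x =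
      (geomRep cs hA u (geomRep cs hA v x) - geomRep cs hA v x) + (geomRep cs hA v x - x) := by
    rw [geomRep_mul_apply]; abel
  change geomRep cs hA (u * v) x - x ∈ _
  rw [this]
  exact Submodule.add_mem_sup (geomRep_sub_mem_mov cs hA u _) (geomRep_sub_mem_mov cs hA v _)

theorem mov_conj (u w : W) :
    mov cs hA (u * w * u⁻¹) = (mov cs hA w).map (geomRep cs hA u : (B → ℝ) →ₗ[ℝ] (B → ℝ)) := by
  ext y
  simp only [Submodule.mem_map, mem_mov]
  constructor
  · rintro ⟨x, rfl⟩
    refine ⟨_, ⟨geomRep cs hA u⁻¹ x, rfl⟩, ?_⟩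
    simp [map_sub]
  · rintro ⟨_, ⟨x, rfl⟩, rfl⟩
    refine ⟨geomRep cs hA u x, ?_⟩
    simp [map_sub]

theorem mov_inv (w : W) : mov cs hA w⁻¹ = mov cs hA w := by
  have key : ∀ w, mov cs hA w⁻¹ ≤ mov cs hA w := by
    rintro w _ ⟨x, rfl⟩
    refine ⟨-(geomRep cs hA w⁻¹ x), ?_⟩
    change geomRep cs hA w (-(geomRep cs hA w⁻¹ x)) - -(geomRep cs hA w⁻¹ x) =
      geomRep cs hA w⁻¹ x - x
    rw [map_neg, geomRep_apply_inv_self]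
    abel
  exact le_antisymm (key w) (by simpa using key w⁻¹)

theorem exists_isRootOf {t : W} (ht : cs.IsReflection t) : ∃ v, IsRootOf cs hA t v := by
  obtain ⟨u, i, h⟩ := ht
  exact ⟨_, u, i, h, rfl⟩

theorem mov_simple_le (i : B) : mov cs hA (cs.simple i) ≤ Submodule.span ℝ {simpleRoot i} := by
  rintro _ ⟨x, rfl⟩
  change geomRep cs hA (cs.simple i) x - x ∈ _
  rw [geomRep_simple, refl_apply, sub_sub_cancel_left]
  exact neg_mem (Submodule.smul_mem _ _ (Submodule.mem_span_singleton_self _))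

theorem refl_simpleRoot (i : B) : refl hA i (simpleRoot i) = -simpleRoot i := by
  rw [refl_apply, coroot_self hA, two_smul]; abel

theorem mov_eq_span_root {t : W} {v : B → ℝ} (hv : IsRootOf cs hA t v) :
    mov cs hA t = Submodule.span ℝ {v} := by
  obtain ⟨u, i, rfl, rfl⟩ := hv
  have : mov cs hA (cs.simple i) = Submodule.span ℝ {simpleRoot i} := by
    refine le_antisymm (mov_simple_le cs hA i) ?_
    rw [Submodule.span_singleton_le_iff_mem]
    refine ⟨-(2⁻¹ : ℝ) • simpleRoot i, ?_⟩
    change geomRep cs hA (cs.simple i) (-(2⁻¹ : ℝ) • simpleRoot i) - -(2⁻¹ : ℝ) • simpleRoot i = _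
    rw [geomRep_simple, map_smul, refl_simpleRoot]
    module
  rw [mov_conj, this, Submodule.map_span, Set.image_singleton]
  rfl

theorem finrank_mov_reflection_le {t : W} (ht : cs.IsReflection t) :
    Module.finrank ℝ (mov cs hA t) ≤ 1 := by
  obtain ⟨v, hv⟩ := exists_isRootOf cs hA ht
  rw [mov_eq_span_root cs hA hv]
  exact (finrank_span_le_card _).trans (by simp)

theorem mov_prod_le (L : List W) : mov cs hA L.prod ≤ ⨆ t ∈ L, mov cs hA t := by
  induction L with
  | nil => simp [mov_one]
  | cons t L ih =>
    rw [List.prod_cons]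
    refine (mov_mul_le cs hA _ _).trans (sup_le ?_ (ih.trans ?_))
    · exact le_iSup₂_of_le t (by simp) le_rfl
    · exact iSup₂_le fun r hr => le_iSup₂_of_le r (by simp [hr]) le_rfl

theorem finrank_mov_mul_le (u v : W) : Module.finrank ℝ (mov cs hA (u * v)) ≤
    Module.finrank ℝ (mov cs hA u) + Module.finrank ℝ (mov cs hA v) :=
  (Submodule.finrank_mono (mov_mul_le cs hA u v)).trans (Submodule.finrank_add_le_finrank_add_finrank _ _)

theorem finrank_mov_le_absLength (w : W) : Module.finrank ℝ (mov cs hA w) ≤ absLength cs w := by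
  obtain ⟨L, h1, h2, rfl⟩ := exists_reflections_prod_eq cs w
  rw [← h1]
  clear h1
  induction L with
  | nil => rw [List.prod_nil, mov_one]; simp
  | cons t L ih =>
    rw [List.prod_cons, List.length_cons, add_comm]
    exact (finrank_mov_mul_le cs hA _ _).trans
      (add_le_add (finrank_mov_reflection_le cs hA (h2 t (by simp)))
        (ih fun r hr => h2 r (by simp [hr])))

/-- Only the zero vector is fixed by all simple reflections. -/
def FixedPointFree (A : Matrix B B ℝ) : Prop :=
  ∀ v : B → ℝ, (∀ i, coroot A i v = 0) → v = 0

theorem geomRep_wordProd_sub_mem (l : List B) (x : B → ℝ) :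
    geomRep cs hA (cs.wordProd l) x - x ∈ Submodule.span ℝ (simpleRoot '' {i | i ∈ l}) := by
  induction l generalizing x with
  | nil => simp
  | cons i l ih =>
    rw [cs.wordProd_cons, geomRep_mul_apply, geomRep_simple, refl_apply]
    rw [show ∀ a b : B → ℝ, a - b - x = (a - x) - b from fun a b => by abel]
    refine sub_mem (Submodule.span_mono (Set.image_mono fun j hj => ?_) (ih x))
      (Submodule.smul_mem _ _ (Submodule.subset_span ⟨i, by simp, rfl⟩))
    exact List.mem_cons_of_mem _ hj

omit [Fintype B] in
theorem apply_eq_zero_of_mem_span_simpleRoot {s : Set B} {v : B → ℝ}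
    (hv : v ∈ Submodule.span ℝ (simpleRoot '' s)) {i : B} (hi : i ∉ s) : v i = 0 := by
  have : Submodule.span ℝ (simpleRoot '' s) ≤ LinearMap.ker (LinearMap.proj (R := ℝ) (φ := fun _ : B => ℝ) i) := by
    rw [Submodule.span_le]
    rintro _ ⟨j, hj, rfl⟩
    have : i ≠ j := by rintro rfl; exact hi hj
    simp [simpleRoot, this]
  exact this hv

/-- Let y be the image of x under the tail of the word. Fixedness makes y - x a multiple of the
first simple root, while y - x also lies in the span of the remaining ones. As simple roots are
independent and the letters distinct, y = x, and the argument recurses. -/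
theorem coroot_eq_zero_of_geomRep_wordProd {l : List B} (hl : l.Nodup) {x : B → ℝ}
    (hx : geomRep cs hA (cs.wordProd l) x = x) : ∀ i ∈ l, coroot A i x = 0 := by
  induction l with
  | nil => simp
  | cons i l ih =>
    rw [List.nodup_cons] at hl
    rw [cs.wordProd_cons, geomRep_mul_apply, geomRep_simple, refl_apply] at hx
    set y := geomRep cs hA (cs.wordProd l) x with hy
    have h1 : (y - x) i = 0 :=
      apply_eq_zero_of_mem_span_simpleRoot (geomRep_wordProd_sub_mem cs hA l x) hl.1
    have h2 : y - x = coroot A i y • simpleRoot i := by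
      rw [sub_eq_iff_eq_add] at hx ⊢
      rw [add_comm]
      exact hx
    have h3 : coroot A i y = 0 := by
      rw [h2] at h1
      simpa [simpleRoot] using h1
    have h4 : y = x := by rw [h3, zero_smul, sub_eq_zero] at h2; exact h2
    intro j hj
    rcases List.mem_cons.1 hj with rfl | hj
    · rw [← h4]; exact h3
    · exact ih hl.2 h4 j hj

theorem mov_eq_top_iff {w : W} :
    mov cs hA w = ⊤ ↔ ∀ x, geomRep cs hA w x = x → x = 0 := by
  rw [mov, ← LinearMap.ker_eq_bot_iff_range_eq_top, LinearMap.ker_eq_bot']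
  simp [sub_eq_zero]

theorem mov_coxeterElement (hF : FixedPointFree A) {c : W} (hc : IsCoxeterElement cs c) :
    mov cs hA c = ⊤ := by
  obtain ⟨l, h1, h2, w, rfl⟩ := hc
  rw [mov_conj, mov_eq_top_iff cs hA |>.2, Submodule.map_top]
  · exact LinearEquiv.range _
  · intro x hx
    exact hF x fun i => coroot_eq_zero_of_geomRep_wordProd cs hA h1 hx i (h2 i)

omit [DecidableEq B] in
theorem absLength_coxeterElement_le {c : W} (hc : IsCoxeterElement cs c) :
    absLength cs c ≤ Fintype.card B := by
  obtain ⟨l, h1, h2, w, rfl⟩ := hc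
  rw [absLength_conj, CoxeterSystem.wordProd]
  refine (absLength_prod_le cs ?_).trans ?_
  · intro t ht
    obtain ⟨i, -, rfl⟩ := List.mem_map.1 ht
    exact cs.isReflection_simple i
  · rw [List.length_map]
    exact List.Nodup.length_le_card h1

/-- Averaging: the sum P of all group elements kills each simple root, because reindexing by its
reflection changes the sign, so P = 0. On a vector fixed by W, however, P is multiplication by the
order of W. -/
theorem fixedPointFree_of_finite [Finite W] (cs : CoxeterSystem M W) (hA : IsCartan M A) :
    FixedPointFree A := by
  intro v hv
  have := Fintype.ofFinite W
  have hfix : ∀ w, geomRep cs hA w v = v := by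
    intro w
    induction w using cs.simple_induction_left with
    | one => simp
    | mul_simple_left w i ih =>
      rw [geomRep_mul_apply, ih, geomRep_simple, refl_apply, hv, zero_smul, sub_zero]
  let P : (B → ℝ) →ₗ[ℝ] (B → ℝ) := ∑ w : W, (geomRep cs hA w : (B → ℝ) →ₗ[ℝ] (B → ℝ))
  have hP : ∀ x, P x = ∑ w : W, geomRep cs hA w x := fun x => by simp [P]
  have hroot : ∀ i, P (simpleRoot i) = 0 := by
    intro i
    have : P (simpleRoot i) = -P (simpleRoot i) := by
      conv_lhs => rw [hP, ← Equiv.sum_comp (Equiv.mulRight (cs.simple i))]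
      simp only [Equiv.coe_mulRight, geomRep_mul_apply, geomRep_simple, refl_simpleRoot, map_neg,
        Finset.sum_neg_distrib, hP]
    exact self_eq_neg.1 this
  have hP0 : P = 0 := by
    refine (Pi.basisFun ℝ B).ext fun i => ?_
    simpa [simpleRoot] using hroot i
  have h1 : P v = Fintype.card W • v := by
    rw [hP, Finset.sum_congr rfl fun w _ => hfix w, Finset.sum_const, Finset.card_univ]
  rw [hP0, LinearMap.zero_apply] at h1
  exact (smul_eq_zero.1 h1.symm).resolve_left Fintype.card_ne_zero

variable {cs hA} {c : W}

theorem absLength_of_mov_eq_top (hc : IsCoxeterElement cs c) (hm : mov cs hA c = ⊤) :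
    absLength cs c = Fintype.card B := by
  refine le_antisymm (absLength_coxeterElement_le cs hc) ?_
  have := finrank_mov_le_absLength cs hA c
  rwa [hm, finrank_top, Module.finrank_fintype_fun_eq_card] at this

/-- Dimension is subadditive and bounded by length for both w and w⁻¹c. Their lengths add up to n
and their dimensions to at least n, so no inequality can be strict. -/
theorem finrank_mov_of_absLE (hc : IsCoxeterElement cs c) (hm : mov cs hA c = ⊤) {w : W}
    (hw : AbsLE cs w c) : Module.finrank ℝ (mov cs hA w) = absLength cs w := by
  have h1 := finrank_mov_mul_le cs hA w (w⁻¹ * c)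
  rw [mul_inv_cancel_left, hm, finrank_top, Module.finrank_fintype_fun_eq_card] at h1
  have h2 := finrank_mov_le_absLength cs hA w
  have h3 := finrank_mov_le_absLength cs hA (w⁻¹ * c)
  have h4 := absLength_of_mov_eq_top hc hm
  unfold AbsLE at hw
  omega

/-- In a reduced factorization of `c`, an earlier reflection subordinates a later one. -/
theorem subordinates_of_mem (hc : IsCoxeterElement cs c) (hm : mov cs hA c = ⊤) {L L' : List W}
    (hL : ∀ t ∈ L, cs.IsReflection t) (hL' : ∀ t ∈ L', cs.IsReflection t)
    (h : c = L.prod * L'.prod) (hlen : L.length + L'.length = Fintype.card B)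
    {t t' : W} (ht : t ∈ L) (ht' : t' ∈ L') : Subordinates cs c t t' := by
  obtain ⟨x, y, rfl⟩ := List.append_of_mem ht
  obtain ⟨x', y', rfl⟩ := List.append_of_mem ht'
  have hcard := absLength_of_mov_eq_top hc hm
  have hx := absLength_prod_le cs (ts := x) fun r hr => hL r (by simp [hr])
  have hy := absLength_prod_le cs (ts := y) fun r hr => hL r (by simp [hr])
  have hx' := absLength_prod_le cs (ts := x') fun r hr => hL' r (by simp [hr])
  have hy' := absLength_prod_le cs (ts := y') fun r hr => hL' r (by simp [hr])
  have hyx := absLength_mul_le cs y.prod x'.prod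
  simp only [List.length_append, List.length_cons] at hlen
  have ht1 := hL t ht
  have ht2 := hL' t' ht'
  have e : c = x.prod * t * (y.prod * x'.prod) * t' * y'.prod := by
    rw [h]; simp [mul_assoc]
  refine ⟨ht1, ht2, ?_, absLE_of_factorization cs e ht1 ht2 (by omega)⟩
  -- If the two reflections coincided, conjugating the part between them would write c with n - 2
  -- reflections.
  rintro rfl
  have e2 : c = x.prod * (t * (y.prod * x'.prod) * t⁻¹) * y'.prod := by
    rw [e, ht1.inv]; simp [mul_assoc]
  have h5 := absLength_mul_le cs (x.prod * (t * (y.prod * x'.prod) * t⁻¹)) y'.prod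
  have h6 := absLength_mul_le cs x.prod (t * (y.prod * x'.prod) * t⁻¹)
  rw [absLength_conj] at h6
  rw [← e2] at h5
  omega

end Mov

/-! ## Orthogonal complements -/

section Orthogonal

variable {K V : Type*} [Field K] [AddCommGroup V] [Module K V] [FiniteDimensional K V]
  {b : LinearMap.BilinForm K V}

theorem orthogonal_flip_orthogonal (hb : b.Nondegenerate) (U : Submodule K V) :
    b.orthogonal (b.flip.orthogonal U) = U := by
  refine (Submodule.eq_of_le_of_finrank_le (fun u hu x hx => hx u hu) ?_).symm
  have := U.finrank_le
  rw [LinearMap.BilinForm.finrank_orthogonal hb, LinearMap.BilinForm.finrank_orthogonal hb.flip]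
  omega

theorem flip_orthogonal_orthogonal (hb : b.Nondegenerate) (U : Submodule K V) :
    b.flip.orthogonal (b.orthogonal U) = U :=
  orthogonal_flip_orthogonal hb.flip U

/-- The form need not be symmetric, so the inverse of the right complement is the left one, that is,
the complement for `b.flip`. -/
theorem isLatticeAntiAut_orthogonal (hb : b.Nondegenerate) :
    IsLatticeAntiAut (fun U : Submodule K V => b.orthogonal U) := by
  refine ⟨⟨fun U U' h => ?_, fun U => ⟨_, orthogonal_flip_orthogonal hb U⟩⟩, fun U U' => ⟨fun h => ?_,
    LinearMap.BilinForm.orthogonal_le⟩⟩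
  · rw [← flip_orthogonal_orthogonal hb U, ← flip_orthogonal_orthogonal hb U']
    exact congrArg _ h
  · rw [← flip_orthogonal_orthogonal hb U, ← flip_orthogonal_orthogonal hb U']
    exact LinearMap.BilinForm.orthogonal_le h

theorem orthogonal_eq_of_finrank_le (hb : b.Nondegenerate) {U U' : Submodule K V}
    (h : ∀ x ∈ U, ∀ y ∈ U', b x y = 0)
    (hd : Module.finrank K V ≤ Module.finrank K U + Module.finrank K U') : b.orthogonal U = U' := by
  have hle : U' ≤ b.orthogonal U := fun y hy x hx => h x hx y hy
  refine (Submodule.eq_of_le_of_finrank_le hle ?_).symm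
  rw [LinearMap.BilinForm.finrank_orthogonal hb]
  omega

theorem orthogonal_eq_of_sup_eq_top (hb : b.Nondegenerate) {U U' : Submodule K V}
    (h : ∀ x ∈ U, ∀ y ∈ U', b x y = 0) (hd : U ⊔ U' = ⊤) : b.orthogonal U = U' := by
  refine orthogonal_eq_of_finrank_le hb h ?_
  rw [← finrank_top K V, ← hd]
  exact Submodule.finrank_add_le_finrank_add_finrank _ _

omit [FiniteDimensional K V] in
theorem bilin_eq_zero_of_mem_span {s t : Set V} (h : ∀ x ∈ s, ∀ y ∈ t, b x y = 0) :
    ∀ x ∈ Submodule.span K s, ∀ y ∈ Submodule.span K t, b x y = 0 := by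
  have h1 : ∀ x ∈ s, Submodule.span K t ≤ LinearMap.ker (b x) := fun x hx =>
    Submodule.span_le.2 fun y hy => h x hx y hy
  intro x hx y hy
  have h2 : Submodule.span K s ≤ LinearMap.ker (b.flip y) :=
    Submodule.span_le.2 fun x hx => h1 x hx hy
  exact h2 hx

end Orthogonal

/-! ## The criterion in the real case -/

section Real

variable {B W : Type*} [Fintype B] [DecidableEq B] [Group W] {M : CoxeterMatrix B}
  {A : Matrix B B ℝ} (cs : CoxeterSystem M W) (hA : IsCartan M A) {c : W}

theorem iSup_mov_eq_span {L : List W} {v : W → B → ℝ}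
    (hv : ∀ t ∈ L, IsRootOf cs hA t (v t)) :
    ⨆ t ∈ L, mov cs hA t = Submodule.span ℝ (v '' {t | t ∈ L}) := by
  rw [Set.image_eq_iUnion, Submodule.span_iUnion₂]
  exact iSup_congr fun t => iSup_congr fun ht => mov_eq_span_root cs hA (hv t ht)

theorem exists_root_choice (L : List W) (hL : ∀ t ∈ L, cs.IsReflection t) :
    ∃ v : W → B → ℝ, ∀ t ∈ L, IsRootOf cs hA t (v t) := by
  classical
  refine ⟨fun t => if h : cs.IsReflection t then (exists_isRootOf cs hA h).choose else 0,
    fun t ht => ?_⟩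
  simp only [dif_pos (hL t ht)]
  exact (exists_isRootOf cs hA (hL t ht)).choose_spec

theorem finrank_iSup_mov_le {L : List W} (hL : ∀ t ∈ L, cs.IsReflection t) :
    Module.finrank ℝ (⨆ t ∈ L, mov cs hA t : Submodule ℝ (B → ℝ)) ≤ L.length := by
  induction L with
  | nil => simp
  | cons t L ih =>
    have hle : (⨆ r ∈ t :: L, mov cs hA r) ≤ mov cs hA t ⊔ ⨆ r ∈ L, mov cs hA r := by
      refine iSup₂_le fun r hr => ?_
      rcases List.mem_cons.1 hr with rfl | hr
      · exact le_sup_left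
      · exact le_sup_of_le_right (le_iSup₂_of_le r hr le_rfl)
    rw [List.length_cons, add_comm]
    exact (Submodule.finrank_mono hle).trans
      ((Submodule.finrank_add_le_finrank_add_finrank _ _).trans
        (add_le_add (finrank_mov_reflection_le cs hA (hL t (by simp)))
          (ih fun r hr => hL r (by simp [hr]))))

variable {cs hA}

/-- The moved space of a non-crossing partition is spanned by the roots of the reflections in a
reduced factorization. -/
theorem mov_eq_iSup (hc : IsCoxeterElement cs c) (hm : mov cs hA c = ⊤) {L : List W}
    (hL : ∀ t ∈ L, cs.IsReflection t) (hw : AbsLE cs L.prod c)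
    (hlen : L.length = absLength cs L.prod) :
    mov cs hA L.prod = ⨆ t ∈ L, mov cs hA t := by
  refine Submodule.eq_of_le_of_finrank_le (mov_prod_le cs hA L) ?_
  rw [finrank_mov_of_absLE hc hm hw, ← hlen]
  exact finrank_iSup_mov_le cs hA hL

/-- Every reflection in a reduced factorization of w subordinates every reflection in one of w⁻¹c.
This gives orthogonality of the two moved spaces, and their dimensions add up to n. -/
theorem complementExtends_mov (hc : IsCoxeterElement cs c) (hm : mov cs hA c = ⊤)
    {b : LinearMap.BilinForm ℝ (B → ℝ)} (hb : b.Nondegenerate)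
    (h : ∀ s t, Subordinates cs c s t → ∀ u v, IsRootOf cs hA s u → IsRootOf cs hA t v →
      b u v = 0) :
    ComplementExtends (fun w : NC cs c => mov cs hA w.1) (kreweras cs c) b := by
  refine ⟨isLatticeAntiAut_kreweras cs c, isLatticeAntiAut_orthogonal hb, ?_⟩
  rintro ⟨w, hw⟩
  change b.orthogonal (mov cs hA w) = mov cs hA (w⁻¹ * c)
  obtain ⟨L, h1, h2, h3⟩ := exists_reflections_prod_eq cs w
  obtain ⟨L', h1', h2', h3'⟩ := exists_reflections_prod_eq cs (w⁻¹ * c)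
  have hcard := absLength_of_mov_eq_top hc hm
  refine orthogonal_eq_of_finrank_le hb ?_ ?_
  · obtain ⟨v, hv⟩ := exists_root_choice cs hA L h2
    obtain ⟨v', hv'⟩ := exists_root_choice cs hA L' h2'
    have hle := mov_prod_le cs hA L
    have hle' := mov_prod_le cs hA L'
    rw [iSup_mov_eq_span cs hA hv, h3] at hle
    rw [iSup_mov_eq_span cs hA hv', h3'] at hle'
    intro x hx y hy
    refine bilin_eq_zero_of_mem_span ?_ x (hle hx) y (hle' hy)
    rintro _ ⟨t, ht, rfl⟩ _ ⟨t', ht', rfl⟩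
    refine h t t' (subordinates_of_mem hc hm h2 h2' ?_ ?_ ht ht') _ _ (hv t ht) (hv' t' ht')
    · rw [h3, h3', mul_inv_cancel_left]
    · rw [h1, h1', ← hcard, hw]
  · rw [finrank_mov_of_absLE hc hm hw, finrank_mov_of_absLE hc hm (absLE_kreweras hw),
      Module.finrank_fintype_fun_eq_card, ← hcard, hw]

end Real

/-! ## The criterion modulo a prime -/

/-- Cramer's rule: det R times z is an integral combination of the rows of R. The coefficients
outside s vanish over ℝ, hence over ℤ, and det R is invertible in K. Independence over K thus
prevents lattice points of a real span from leaving the span after reduction. -/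
theorem intCast_mem_span_of_mem_span {B ι K : Type*} [Fintype B] [DecidableEq B] [Fintype ι]
    [Field K] (hcard : Fintype.card ι = Fintype.card B) {v : ι → B → ℤ}
    (hli : LinearIndependent K (fun i k => (v i k : K))) {s : Set ι} {z : B → ℤ}
    (hz : (fun k => (z k : ℝ)) ∈ Submodule.span ℝ ((fun i k => (v i k : ℝ)) '' s)) :
    (fun k => (z k : K)) ∈ Submodule.span K ((fun i k => (v i k : K)) '' s) := by
  obtain ⟨e⟩ := Fintype.card_eq.1 hcard.symm
  let R : Matrix B B ℤ := Matrix.of fun k => v (e k)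
  have hdet : ((R.det : ℤ) : K) ≠ 0 := by
    have : LinearIndependent K (R.map (Int.cast : ℤ → K)).row := hli.comp e e.injective
    rw [Matrix.linearIndependent_rows_iff_isUnit, Matrix.isUnit_iff_isUnit_det] at this
    have h2 := RingHom.map_det (Int.castRingHom K) R
    rw [eq_intCast] at h2
    rw [h2]
    exact this.ne_zero
  let y : B → ℤ := Matrix.vecMul z R.adjugate
  have hy : ∀ k, e k ∉ s → y k = 0 := by
    intro k hk
    have hcast : ((y k : ℤ) : ℝ) =
        Matrix.vecMul (fun j => (z j : ℝ)) (R.adjugate.map (Int.cast : ℤ → ℝ)) k := by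
      simp [y, Matrix.vecMul, dotProduct]
    -- Column k of the adjugate defines a functional that kills every row of R except row k, since R
    -- * adj R = det R.
    have hle : Submodule.span ℝ ((fun i k => (v i k : ℝ)) '' s) ≤
        LinearMap.ker (LinearMap.proj k ∘ₗ
          Matrix.vecMulLinear (R.adjugate.map (Int.cast : ℤ → ℝ))) := by
      rw [Submodule.span_le]
      rintro _ ⟨i, hi, rfl⟩
      have hik : e.symm i ≠ k := by rintro rfl; simp [hi] at hk
      have h3 : (R * R.adjugate) (e.symm i) k = 0 := by
        rw [Matrix.mul_adjugate, Matrix.smul_apply, Matrix.one_apply_ne hik, smul_zero]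
      have h4 : ((∑ j, v i j * R.adjugate j k : ℤ) : ℝ) = 0 := by
        rw [Matrix.mul_apply] at h3
        simpa [R] using congrArg (Int.cast : ℤ → ℝ) h3
      simpa [Matrix.vecMul, dotProduct] using h4
    have := hle hz
    rw [LinearMap.mem_ker] at this
    have h5 : ((y k : ℤ) : ℝ) = 0 := hcast.trans this
    exact_mod_cast h5
  have hyz : Matrix.vecMul y R = R.det • z := by
    rw [Matrix.vecMul_vecMul, Matrix.adjugate_mul, Matrix.vecMul_smul, Matrix.vecMul_one]
  have hsum : (R.det : K) • (fun k => (z k : K)) = ∑ k, (y k : K) • fun j => (v (e k) j : K) := by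
    ext j
    have := congrArg (Int.cast : ℤ → K) (congrFun hyz j)
    simp only [Matrix.vecMul, dotProduct, R, Matrix.of_apply, Pi.smul_apply, smul_eq_mul,
      Int.cast_mul, Int.cast_sum] at this
    simp [← this, R]
  rw [← Submodule.smul_mem_iff _ hdet, hsum]
  refine Submodule.sum_mem _ fun k _ => ?_
  by_cases hk : e k ∈ s
  · exact Submodule.smul_mem _ _ (Submodule.subset_span ⟨e k, hk, rfl⟩)
  · rw [hy k hk, Int.cast_zero, zero_smul]
    exact Submodule.zero_mem _

section Prime

variable {B W : Type*} [Fintype B] [DecidableEq B] [Group W] {M : CoxeterMatrix B}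
  {A : Matrix B B ℤ} (cs : CoxeterSystem M W) (hA : IsCartan M (A.map (Int.cast : ℤ → ℝ)))
  {c : W}

theorem exists_int_geomRep (w : W) (z : B → ℤ) :
    ∃ z' : B → ℤ, geomRep cs hA w (fun i => (z i : ℝ)) = fun i => (z' i : ℝ) := by
  induction w using cs.simple_induction_left with
  | one => exact ⟨z, by simp⟩
  | mul_simple_left w i ih =>
    obtain ⟨z', h⟩ := ih
    refine ⟨z' - Matrix.vecMul z' A i • Pi.single i 1, ?_⟩
    rw [geomRep_mul_apply, h, geomRep_simple, refl_apply]
    ext k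
    simp [coroot, simpleRoot, Matrix.vecMul, dotProduct, Pi.single_apply]

theorem exists_isIntRootOf {t : W} (ht : cs.IsReflection t) : ∃ z, IsIntRootOf cs hA t z := by
  obtain ⟨u, i, h⟩ := ht
  obtain ⟨z, hz⟩ := exists_int_geomRep cs hA u (Pi.single i 1)
  refine ⟨z, u, i, h, ?_⟩
  rw [← hz]
  congr 1
  ext k
  by_cases hk : k = i
  · subst hk; simp [simpleRoot]
  · simp [simpleRoot, hk]

/-- The roots of the reflections in every reduced factorization of `c` are linearly independent
over `K`. -/
def CompatibleAt (c : W) (K : Type*) [Field K] : Prop :=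
  ∀ L : List W, (∀ t ∈ L, cs.IsReflection t) → L.prod = c → L.length = Fintype.card B →
    ∀ v : Fin L.length → B → ℤ, (∀ i, IsIntRootOf cs hA (L.get i) (v i)) →
      LinearIndependent K (fun i k => (v i k : K))

variable {cs hA}

/-- The n roots span a space containing mov(c) = V, so they form a basis. This is what lets
compatibility of p be applied to them. -/
theorem linearIndependent_roots (hm : mov cs hA c = ⊤) {L : List W} (hp : L.prod = c)
    (hlen : L.length = Fintype.card B) {v : Fin L.length → B → ℤ}
    (hv : ∀ i, IsIntRootOf cs hA (L.get i) (v i)) :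
    LinearIndependent ℝ (fun i k => (v i k : ℝ)) := by
  refine linearIndependent_of_top_le_span_of_card_eq_finrank ?_
    (by rw [Fintype.card_fin, hlen, Module.finrank_fintype_fun_eq_card])
  rw [← hm, ← hp]
  refine (mov_prod_le cs hA L).trans (iSup₂_le fun t ht => ?_)
  obtain ⟨i, rfl⟩ := List.mem_iff_get.1 ht
  rw [mov_eq_span_root cs hA (hv i)]
  exact Submodule.span_mono (by rintro _ rfl; exact ⟨i, rfl⟩)

theorem Compatible.compatibleAt {p : ℕ} [Fact p.Prime] (hp : Compatible cs hA p)
    (hm : mov cs hA c = ⊤) : CompatibleAt cs hA c (ZMod p) := by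
  intro L _ hprod hlen v hv
  have e : B ≃ Fin L.length := Fintype.equivOfCardEq (by rw [Fintype.card_fin, hlen])
  have h := hp (fun k => v (e k)) (fun k => ⟨_, hv (e k)⟩)
    ((linearIndependent_roots hm hprod hlen hv).comp e e.injective)
  have := h.comp e.symm e.symm.injective
  simpa [Function.comp_def] using this

/-- A lattice point of the moved space is only a real combination of the roots of `L'`. Embedding
these roots in the family of `L`, of full size and independent modulo p, allows the Cramer argument
to reduce the combination. -/
theorem movP_eq_span (hc : IsCoxeterElement cs c) (hm : mov cs hA c = ⊤) {p : ℕ} [Fact p.Prime]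
    {L L' : List W} (hcard : L.length = Fintype.card B) {v : Fin L.length → B → ℤ}
    (hv : ∀ i, IsIntRootOf cs hA (L.get i) (v i))
    (hli : LinearIndependent (ZMod p) (fun i k => (v i k : ZMod p)))
    (hsub : ∀ t ∈ L', t ∈ L) (hL' : ∀ t ∈ L', cs.IsReflection t) (hw : AbsLE cs L'.prod c)
    (hlen : L'.length = absLength cs L'.prod) :
    movP cs hA p L'.prod = Submodule.span (ZMod p)
      ((fun i k => (v i k : ZMod p)) '' {i | L.get i ∈ L'}) := by
  have hmov := mov_eq_iSup hc hm hL' hw hlen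
  refine le_antisymm (Submodule.span_le.2 ?_) (Submodule.span_le.2 ?_)
  · rintro _ ⟨z, hz, rfl⟩
    refine intCast_mem_span_of_mem_span (by rw [Fintype.card_fin, hcard]) hli ?_
    rw [hmov] at hz
    refine (iSup₂_le fun t ht => ?_ : (⨆ t ∈ L', mov cs hA t) ≤ _) hz
    obtain ⟨i, rfl⟩ := List.mem_iff_get.1 (hsub t ht)
    rw [mov_eq_span_root cs hA (hv i)]
    exact Submodule.span_mono (by rintro _ rfl; exact ⟨i, ht, rfl⟩)
  · rintro _ ⟨i, hi, rfl⟩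
    refine Submodule.subset_span ⟨v i, ?_, rfl⟩
    rw [hmov]
    refine (le_iSup₂_of_le (L.get i) hi le_rfl : mov cs hA (L.get i) ≤ _) ?_
    rw [mov_eq_span_root cs hA (hv i)]
    exact Submodule.mem_span_singleton_self _

theorem complementExtends_movP (hc : IsCoxeterElement cs c) (hm : mov cs hA c = ⊤)
    {p : ℕ} [Fact p.Prime] (hp : CompatibleAt cs hA c (ZMod p))
    {b : LinearMap.BilinForm (ZMod p) (B → ZMod p)} (hb : b.Nondegenerate)
    (h : ∀ s t, Subordinates cs c s t → ∀ u v : B → ℤ,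
      IsIntRootOf cs hA s u → IsIntRootOf cs hA t v →
        b (fun i => (u i : ZMod p)) (fun i => (v i : ZMod p)) = 0) :
    ComplementExtends (fun w : NC cs c => movP cs hA p w.1) (kreweras cs c) b := by
  refine ⟨isLatticeAntiAut_kreweras cs c, isLatticeAntiAut_orthogonal hb, ?_⟩
  rintro ⟨w, hw⟩
  change b.orthogonal (movP cs hA p w) = movP cs hA p (w⁻¹ * c)
  obtain ⟨L, h1, h2, h3⟩ := exists_reflections_prod_eq cs w
  obtain ⟨L', h1', h2', h3'⟩ := exists_reflections_prod_eq cs (w⁻¹ * c)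
  have hcard := absLength_of_mov_eq_top hc hm
  have hprod : (L ++ L').prod = c := by rw [List.prod_append, h3, h3', mul_inv_cancel_left]
  have hsum : L.length + L'.length = Fintype.card B := by rw [h1, h1', ← hcard, hw]
  have hrefl : ∀ t ∈ L ++ L', cs.IsReflection t := by
    intro t ht
    rcases List.mem_append.1 ht with ht | ht
    exacts [h2 t ht, h2' t ht]
  have hlen : (L ++ L').length = Fintype.card B := by rw [List.length_append, hsum]
  choose v hv using fun i => exists_isIntRootOf cs hA (hrefl _ ((L ++ L').get_mem i))
  have hli := hp _ hrefl hprod hlen v hv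
  have e := movP_eq_span hc hm hlen hv hli (L' := L) (fun t ht => List.mem_append_left _ ht) h2
    (by rwa [h3]) (by rw [h1, h3])
  have e' := movP_eq_span hc hm hlen hv hli (L' := L') (fun t ht => List.mem_append_right _ ht) h2'
    (by rw [h3']; exact absLE_kreweras hw) (by rw [h1', h3'])
  rw [h3] at e
  rw [h3'] at e'
  rw [e, e']
  refine orthogonal_eq_of_sup_eq_top hb (bilin_eq_zero_of_mem_span ?_) ?_
  · rintro _ ⟨i, hi, rfl⟩ _ ⟨j, hj, rfl⟩
    exact h _ _ (subordinates_of_mem hc hm h2 h2' (by rw [h3, h3', mul_inv_cancel_left]) hsum hi hj)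
      _ _ (hv i) (hv j)
  -- The reduced roots of `L ++ L'` form a basis, so the two orthogonal subspaces together span V.
  · rw [← Submodule.span_union, ← Set.image_union, eq_top_iff,
      ← hli.span_eq_top_of_card_eq_finrank'
        (by rw [Fintype.card_fin, hlen, Module.finrank_fintype_fun_eq_card])]
    refine Submodule.span_mono ?_
    rintro _ ⟨i, rfl⟩
    exact ⟨i, List.mem_append.1 ((L ++ L').get_mem i), rfl⟩

end Prime

/-! ## Invariant forms and Euler forms -/

section Triangular

variable {K V : Type*} [Field K] [AddCommGroup V] [Module K V] {b : LinearMap.BilinForm K V}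
  {m : ℕ} {v : Fin m → V}

/-- The Gram matrix is lower triangular with nonzero diagonal, hence invertible. -/
theorem eq_zero_of_triangular (h0 : ∀ i j, i < j → b (v i) (v j) = 0)
    (h1 : ∀ i, b (v i) (v i) ≠ 0) {x : Fin m → K} (hx : ∀ j, b (∑ i, x i • v i) (v j) = 0) :
    x = 0 := by
  let G : Matrix (Fin m) (Fin m) K := Matrix.of fun i j => b (v i) (v j)
  have hdet : G.det ≠ 0 := by
    rw [Matrix.det_of_isLowerTriangular (M := G) (fun i j hij => h0 i j hij)]
    exact Finset.prod_ne_zero_iff.2 fun i _ => h1 i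
  refine Matrix.eq_zero_of_vecMul_eq_zero hdet ?_
  ext j
  simpa [G, Matrix.vecMul, dotProduct] using hx j

theorem linearIndependent_of_triangular (h0 : ∀ i j, i < j → b (v i) (v j) = 0)
    (h1 : ∀ i, b (v i) (v i) ≠ 0) : LinearIndependent K v := by
  rw [Fintype.linearIndependent_iff]
  intro x hx
  exact congrFun (eq_zero_of_triangular h0 h1 (x := x) fun j => by rw [hx]; simp)

theorem nondegenerate_of_triangular [FiniteDimensional K V] (hm : m = Module.finrank K V)
    (h0 : ∀ i j, i < j → b (v i) (v j) = 0) (h1 : ∀ i, b (v i) (v i) ≠ 0) : b.Nondegenerate := by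
  have hli := linearIndependent_of_triangular h0 h1
  have hspan := hli.span_eq_top_of_card_eq_finrank' (by rw [Fintype.card_fin, hm])
  refine LinearMap.BilinForm.Nondegenerate.ofSeparatingLeft fun x hx => ?_
  have hmem : x ∈ Submodule.span K (Set.range v) := hspan ▸ Submodule.mem_top
  obtain ⟨y, rfl⟩ := (Submodule.mem_span_range_iff_exists_fun K).1 hmem
  rw [eq_zero_of_triangular h0 h1 (x := y) fun j => hx (v j)]
  simp

end Triangular

/-! ### The real Euler form of a Coxeter element -/

section Euler

variable {B W : Type*} [Fintype B] [DecidableEq B] [Group W] {M : CoxeterMatrix B}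

/-- The form `(α i, α j) = A i j * d j`. -/
noncomputable def cartanForm (A : Matrix B B ℝ) (d : B → ℝ) : LinearMap.BilinForm ℝ (B → ℝ) :=
  Matrix.toBilin' (A * Matrix.diagonal d)

theorem cartanForm_simpleRoot (A : Matrix B B ℝ) (d : B → ℝ) (x : B → ℝ) (j : B) :
    cartanForm A d x (simpleRoot j) = coroot A j x * d j := by
  simp [cartanForm, simpleRoot, coroot, Matrix.toBilin'_apply', Matrix.vecMul, dotProduct,
    Finset.sum_mul, mul_assoc]

variable {A : Matrix B B ℝ} {d : B → ℝ}

theorem bilinForm_ext_right {b b' : LinearMap.BilinForm ℝ (B → ℝ)} {x x' : B → ℝ}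
    (h : ∀ j, b x (simpleRoot j) = b' x' (simpleRoot j)) (y : B → ℝ) : b x y = b' x' y := by
  have : b x = b' x' := (Pi.basisFun ℝ B).ext fun j => by simpa [simpleRoot] using h j
  rw [this]

theorem cartanForm_symm (hd : ∀ i j, A i j * d j = A j i * d i) (x y : B → ℝ) :
    cartanForm A d x y = cartanForm A d y x := by
  have : cartanForm A d = (cartanForm A d).flip := by
    refine LinearMap.BilinForm.ext_basis (Pi.basisFun ℝ B) fun i j => ?_
    have e : ∀ k : B, Pi.basisFun ℝ B k = simpleRoot k := fun k => by simp [simpleRoot]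
    rw [LinearMap.BilinForm.flip_apply, e, e, cartanForm_simpleRoot, cartanForm_simpleRoot,
      coroot_simpleRoot, coroot_simpleRoot, hd]
  conv_lhs => rw [this]
  rfl

theorem cartanForm_eq_zero (hF : FixedPointFree A) (h0 : ∀ i, d i ≠ 0) {x : B → ℝ}
    (hx : ∀ y, cartanForm A d x y = 0) : x = 0 := by
  refine hF x fun i => ?_
  have := hx (simpleRoot i)
  rw [cartanForm_simpleRoot] at this
  exact (mul_eq_zero.1 this).resolve_right (h0 i)

variable (cs : CoxeterSystem M W) (hA : IsCartan M A)

theorem cartanForm_geomRep (hd : ∀ i j, A i j * d j = A j i * d i) (w : W) (x y : B → ℝ) :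
    cartanForm A d (geomRep cs hA w x) (geomRep cs hA w y) = cartanForm A d x y := by
  induction w using cs.simple_induction_left with
  | one => simp
  | mul_simple_left w i ih =>
    rw [geomRep_mul_apply, geomRep_mul_apply, ← ih, geomRep_simple, refl_apply, refl_apply]
    simp only [map_sub, map_smul, LinearMap.sub_apply, LinearMap.smul_apply, cartanForm_simpleRoot,
      smul_eq_mul, coroot_self hA]
    rw [cartanForm_symm hd (simpleRoot i), cartanForm_simpleRoot]
    ring

variable {cs hA} {c : W} {b : LinearMap.BilinForm ℝ (B → ℝ)}

/-- For `c = u v` with additive dimensions, the moved space of `v` is orthogonal to the moved space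
of `u` with respect to the form `b` with `b ((1 - c) x, y) = (x, y)`. -/
theorem bilin_mov_mov_eq_zero (hd : ∀ i j, A i j * d j = A j i * d i)
    (hb : ∀ x y, b (x - geomRep cs hA c x) y = cartanForm A d x y) (hm : mov cs hA c = ⊤)
    {u v : W} (huv : c = u * v)
    (hdim : Module.finrank ℝ (mov cs hA u) + Module.finrank ℝ (mov cs hA v) ≤ Fintype.card B) :
    ∀ x ∈ mov cs hA u, ∀ y ∈ mov cs hA v, b x y = 0 := by
  let fc : (B → ℝ) →ₗ[ℝ] (B → ℝ) := LinearMap.id - (geomRep cs hA c : (B → ℝ) →ₗ[ℝ] (B → ℝ))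
  let fv : (B → ℝ) →ₗ[ℝ] (B → ℝ) := (geomRep cs hA v : (B → ℝ) →ₗ[ℝ] (B → ℝ)) - LinearMap.id
  have hinj : Function.Injective fc := by
    rw [← LinearMap.ker_eq_bot, LinearMap.ker_eq_bot']
    intro x hx
    exact (mov_eq_top_iff cs hA).1 hm x (sub_eq_zero.1 hx).symm
  have hfix : ∀ z ∈ LinearMap.ker fv, geomRep cs hA v z = z := fun z hz => sub_eq_zero.1 hz
  -- On Fix(v), the maps 1 - c and 1 - u agree. Since 1 - c is injective, counting dimensions turns
  -- the inclusion into an equality.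
  have hle : (LinearMap.ker fv).map fc ≤ mov cs hA u := by
    rintro _ ⟨z, hz, rfl⟩
    change z - geomRep cs hA c z ∈ _
    rw [huv, geomRep_mul_apply, hfix z hz, ← neg_sub]
    exact neg_mem (geomRep_sub_mem_mov cs hA u z)
  have heq : (LinearMap.ker fv).map fc = mov cs hA u := by
    refine Submodule.eq_of_le_of_finrank_le hle ?_
    rw [← (Submodule.equivMapOfInjective fc hinj (LinearMap.ker fv)).finrank_eq]
    have h1 := LinearMap.finrank_range_add_finrank_ker fv
    rw [Module.finrank_fintype_fun_eq_card] at h1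
    change Module.finrank ℝ (mov cs hA v) + _ = _ at h1
    omega
  intro x hx y hy
  rw [← heq] at hx
  obtain ⟨z, hz, rfl⟩ := hx
  obtain ⟨y', rfl⟩ := hy
  change b (z - geomRep cs hA c z) (geomRep cs hA v y' - y') = 0
  -- It remains to see (z, v y') = (z, y'), which is invariance under v because v z = z.
  rw [hb, map_sub, sub_eq_zero]
  conv_lhs => rw [← hfix z hz]
  exact cartanForm_geomRep cs hA hd v z y'

/-- Write c = s · (t r). Since s t ≤ c, the dimensions of the moved spaces are forced to be 1 and n
- 1, and mov(t r) = mov(t) + mov(r) contains the root of t. -/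
theorem bilin_root_eq_zero (hd : ∀ i j, A i j * d j = A j i * d i)
    (hb : ∀ x y, b (x - geomRep cs hA c x) y = cartanForm A d x y)
    (hc : IsCoxeterElement cs c) (hm : mov cs hA c = ⊤) {s t : W} (hst : Subordinates cs c s t)
    {u v : B → ℝ} (hu : IsRootOf cs hA s u) (hv : IsRootOf cs hA t v) : b u v = 0 := by
  obtain ⟨hs, ht, hne, hle⟩ := hst
  set r := (s * t)⁻¹ * c with hr
  have hcr : c = s * (t * r) := by rw [hr]; group
  have hcard := absLength_of_mov_eq_top hc hm
  unfold AbsLE at hle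
  rw [absLength_mul_reflection cs hs ht hne, ← hr] at hle
  have h1 := finrank_mov_reflection_le cs hA hs
  have h2 := finrank_mov_reflection_le cs hA ht
  have h3 := finrank_mov_le_absLength cs hA r
  have h4 := finrank_mov_mul_le cs hA t r
  have h5 := finrank_mov_mul_le cs hA s (t * r)
  rw [← hcr, hm, finrank_top, Module.finrank_fintype_fun_eq_card] at h5
  have h6 := Submodule.finrank_add_le_finrank_add_finrank (mov cs hA t) (mov cs hA r)
  have h7 : mov cs hA (t * r) = mov cs hA t ⊔ mov cs hA r :=
    Submodule.eq_of_le_of_finrank_le (mov_mul_le cs hA t r) (by omega)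
  refine bilin_mov_mov_eq_zero hd hb hm hcr (by omega) u ?_ v ?_
  · rw [mov_eq_span_root cs hA hu]
    exact Submodule.mem_span_singleton_self u
  · rw [h7, mov_eq_span_root cs hA hv]
    exact Submodule.mem_sup_left (Submodule.mem_span_singleton_self v)

theorem exists_sub_geomRep_eq (hm : mov cs hA c = ⊤) (x : B → ℝ) :
    ∃ y, y - geomRep cs hA c y = x := by
  have hx : -x ∈ mov cs hA c := hm ▸ Submodule.mem_top
  obtain ⟨y, hy⟩ := (mem_mov cs hA).1 hx
  exact ⟨y, by rw [← neg_sub, hy, neg_neg]⟩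

/-- With x = (1 - c)y, both sides equal 2(y, y) - 2(y, cy), because (cy, cy) = (y, y). -/
theorem two_mul_bilin_self (hd : ∀ i j, A i j * d j = A j i * d i)
    (hb : ∀ x y, b (x - geomRep cs hA c x) y = cartanForm A d x y) (hm : mov cs hA c = ⊤)
    (x : B → ℝ) : 2 * b x x = cartanForm A d x x := by
  obtain ⟨y, rfl⟩ := exists_sub_geomRep_eq hm x
  rw [hb]
  simp only [map_sub, LinearMap.sub_apply, cartanForm_geomRep cs hA hd c y y]
  rw [cartanForm_symm hd (geomRep cs hA c y) y]
  ring

theorem exists_bilin_root_self (hd : ∀ i j, A i j * d j = A j i * d i)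
    (hb : ∀ x y, b (x - geomRep cs hA c x) y = cartanForm A d x y) (hm : mov cs hA c = ⊤)
    {t : W} {v : B → ℝ} (hv : IsRootOf cs hA t v) : ∃ i, b v v = d i := by
  have h := two_mul_bilin_self hd hb hm v
  obtain ⟨u, i, -, rfl⟩ := hv
  rw [cartanForm_geomRep cs hA hd, cartanForm_simpleRoot, coroot_self hA] at h
  exact ⟨i, by linarith⟩

theorem nondegenerate_of_cartanForm (hF : FixedPointFree A) (h0 : ∀ i, d i ≠ 0)
    (hb : ∀ x y, b (x - geomRep cs hA c x) y = cartanForm A d x y) (hm : mov cs hA c = ⊤) :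
    b.Nondegenerate := by
  refine LinearMap.BilinForm.Nondegenerate.ofSeparatingLeft fun x hx => ?_
  obtain ⟨y, rfl⟩ := exists_sub_geomRep_eq hm x
  rw [cartanForm_eq_zero hF h0 (x := y) fun z => by rw [← hb]; exact hx z]
  simp

variable (cs hA) in
/-- A form that is triangular in the simple roots in the order of the word, and whose
symmetrization is the invariant form. -/
theorem bilin_sub_wordProd {l : List B} (h1 : ∀ i ∈ l, b (simpleRoot i) (simpleRoot i) = d i)
    (h2 : l.Pairwise fun i j => b (simpleRoot i) (simpleRoot j) = 0 ∧
      b (simpleRoot j) (simpleRoot i) = A j i * d i) (x : B → ℝ) {k : B} (hk : k ∈ l) :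
    b (x - geomRep cs hA (cs.wordProd l) x) (simpleRoot k) = coroot A k x * d k := by
  induction l with
  | nil => simp at hk
  | cons i l ih =>
    rw [List.pairwise_cons] at h2
    rw [cs.wordProd_cons, geomRep_mul_apply, geomRep_simple, refl_apply]
    set y := geomRep cs hA (cs.wordProd l) x with hy
    rw [show x - (y - coroot A i y • simpleRoot i) = (x - y) + coroot A i y • simpleRoot i by abel,
      map_add, LinearMap.add_apply, map_smul, LinearMap.smul_apply, smul_eq_mul]
    rcases List.mem_cons.1 hk with rfl | hk
    -- For the first letter: b(·, α_k) equals d_k⟨·, α_k^∨⟩ on the span of the later simple roots,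
    -- which contains y - x.
    · have hle : Submodule.span ℝ (simpleRoot '' {i | i ∈ l}) ≤
          LinearMap.ker (b.flip (simpleRoot k) - d k • coroot A k) := by
        rw [Submodule.span_le]
        rintro _ ⟨j, hj, rfl⟩
        change b (simpleRoot j) (simpleRoot k) - d k * coroot A k (simpleRoot j) = 0
        rw [(h2.1 j hj).2, coroot_simpleRoot]
        ring
      have h3 := hle (geomRep_wordProd_sub_mem cs hA l x)
      change b (y - x) (simpleRoot k) - d k * coroot A k (y - x) = 0 at h3
      rw [← neg_sub, map_neg, LinearMap.neg_apply, h1 k (by simp), sub_eq_zero.1 h3, map_sub]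
      ring
    · rw [(h2.1 k hk).1, mul_zero, add_zero]
      exact ih (fun j hj => h1 j (by simp [hj])) h2.2 hk

/-- The form is b(x, y) = ((1 - c)⁻¹x, y), where 1 - c is invertible because c has no nonzero fixed
vector. -/
theorem exists_nondegenerate_bilin (hd : ∀ i j, A i j * d j = A j i * d i)
    (hF : FixedPointFree A) (h0 : ∀ i, d i ≠ 0) (hc : IsCoxeterElement cs c) :
    ∃ b : LinearMap.BilinForm ℝ (B → ℝ), b.Nondegenerate ∧
      ComplementExtends (fun w : NC cs c => mov cs hA w.1) (kreweras cs c) b := by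
  have hm := mov_coxeterElement cs hA hF hc
  let fc : (B → ℝ) →ₗ[ℝ] (B → ℝ) := LinearMap.id - (geomRep cs hA c : (B → ℝ) →ₗ[ℝ] (B → ℝ))
  have hinj : Function.Injective fc := by
    rw [← LinearMap.ker_eq_bot, LinearMap.ker_eq_bot']
    intro x hx
    exact (mov_eq_top_iff cs hA).1 hm x (sub_eq_zero.1 hx).symm
  let e := LinearEquiv.ofInjectiveEndo fc hinj
  have hb : ∀ x y, (cartanForm A d).comp e.symm LinearMap.id (x - geomRep cs hA c x) y =
      cartanForm A d x y := by
    intro x y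
    have : e.symm (x - geomRep cs hA c x) = x := e.symm_apply_apply x
    rw [LinearMap.BilinForm.comp_apply, LinearMap.id_apply, LinearEquiv.coe_coe, this]
  have hnd := nondegenerate_of_cartanForm hF h0 hb hm
  exact ⟨_, hnd, complementExtends_mov hc hm hnd
    fun s t hst u v hu hv => bilin_root_eq_zero hd hb hc hm hst hu hv⟩

end Euler

/-! ### Integral Euler forms and their reduction to a field -/

section IntEuler

theorem toBilin'_intCast {B : Type*} [Fintype B] [DecidableEq B] (K : Type*) [Field K]
    (N : Matrix B B ℤ) (u v : B → ℤ) :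
    Matrix.toBilin' (N.map (Int.cast : ℤ → K)) (fun i => (u i : K)) (fun i => (v i : K)) =
      ((∑ i, ∑ j, u i * N i j * v j : ℤ) : K) := by
  simp [Matrix.toBilin'_apply]

variable {B W : Type*} [Fintype B] [DecidableEq B] [Group W] {M : CoxeterMatrix B}
  {A : Matrix B B ℤ} {d : B → ℤ} {cs : CoxeterSystem M W}
  {hA : IsCartan M (A.map (Int.cast : ℤ → ℝ))} {c : W} {N : Matrix B B ℤ}

omit [Fintype B] [DecidableEq B] in
theorem symm_intCast (hd : ∀ i j, A i j * d j = A j i * d i) (i j : B) :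
    A.map (Int.cast : ℤ → ℝ) i j * (d j : ℝ) = A.map (Int.cast : ℤ → ℝ) j i * (d i : ℝ) := by
  simpa using congrArg (Int.cast : ℤ → ℝ) (hd i j)

/-- The form of the integral matrix `N` satisfies `N ((1 - c) x, y) = (x, y)`. -/
def IsEulerMatrix (cs : CoxeterSystem M W) (hA : IsCartan M (A.map (Int.cast : ℤ → ℝ)))
    (d : B → ℤ) (c : W) (N : Matrix B B ℤ) : Prop :=
  ∀ x y, Matrix.toBilin' (N.map (Int.cast : ℤ → ℝ)) (x - geomRep cs hA c x) y =
    cartanForm (A.map (Int.cast : ℤ → ℝ)) (fun i => (d i : ℝ)) x y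

/-- The value is an integer that vanishes over ℝ, so it vanishes in every field. -/
theorem IsEulerMatrix.root_eq_zero (hN : IsEulerMatrix cs hA d c N)
    (hd : ∀ i j, A i j * d j = A j i * d i) (hc : IsCoxeterElement cs c) (hm : mov cs hA c = ⊤)
    (K : Type*) [Field K] {s t : W} (hst : Subordinates cs c s t)
    {u v : B → ℤ} (hu : IsIntRootOf cs hA s u) (hv : IsIntRootOf cs hA t v) :
    Matrix.toBilin' (N.map (Int.cast : ℤ → K)) (fun i => (u i : K)) (fun i => (v i : K)) = 0 := by
  have h := bilin_root_eq_zero (symm_intCast hd) hN hc hm hst hu hv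
  rw [toBilin'_intCast, Int.cast_eq_zero] at h
  rw [toBilin'_intCast, h, Int.cast_zero]

theorem IsEulerMatrix.root_self_ne_zero (hN : IsEulerMatrix cs hA d c N)
    (hd : ∀ i j, A i j * d j = A j i * d i) (hm : mov cs hA c = ⊤)
    (K : Type*) [Field K] (hK : ∀ i, (d i : K) ≠ 0) {t : W} {v : B → ℤ}
    (hv : IsIntRootOf cs hA t v) :
    Matrix.toBilin' (N.map (Int.cast : ℤ → K)) (fun i => (v i : K)) (fun i => (v i : K)) ≠ 0 := by
  obtain ⟨i, hi⟩ := exists_bilin_root_self (symm_intCast hd) hN hm hv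
  rw [toBilin'_intCast, Int.cast_inj] at hi
  rw [toBilin'_intCast, hi]
  exact hK i

theorem IsEulerMatrix.triangular (hN : IsEulerMatrix cs hA d c N)
    (hd : ∀ i j, A i j * d j = A j i * d i) (hc : IsCoxeterElement cs c) (hm : mov cs hA c = ⊤)
    (K : Type*) [Field K] {L : List W} (hL : ∀ t ∈ L, cs.IsReflection t)
    (hprod : L.prod = c) (hlen : L.length = Fintype.card B) {v : Fin L.length → B → ℤ}
    (hv : ∀ i, IsIntRootOf cs hA (L.get i) (v i)) (i j : Fin L.length) (hij : i < j) :
    Matrix.toBilin' (N.map (Int.cast : ℤ → K)) (fun k => (v i k : K)) (fun k => (v j k : K)) =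
      0 := by
  refine hN.root_eq_zero hd hc hm K ?_ (hv i) (hv j)
  -- Cutting just before position j leaves entry i in the first part and makes entry j the head of
  -- the second.
  refine subordinates_of_mem hc hm (L := L.take j) (L' := L.drop j)
    (fun t ht => hL t (List.mem_of_mem_take ht)) (fun t ht => hL t (List.mem_of_mem_drop ht))
    (by rw [List.prod_take_mul_prod_drop, hprod]) ?_ ?_ ?_
  · rw [← List.length_append, List.take_append_drop, hlen]
  · rw [List.mem_take_iff_getElem]
    exact ⟨i, by simpa using hij, rfl⟩
  · rw [List.mem_drop_iff_getElem]
    exact ⟨0, by simp, by simp⟩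

/-- The triangular Gram matrix replaces compatibility of p with the whole root system: only the
diagonal values d_i must survive in K. -/
theorem IsEulerMatrix.compatibleAt (hN : IsEulerMatrix cs hA d c N)
    (hd : ∀ i j, A i j * d j = A j i * d i) (hc : IsCoxeterElement cs c) (hm : mov cs hA c = ⊤)
    (K : Type*) [Field K] (hK : ∀ i, (d i : K) ≠ 0) : CompatibleAt cs hA c K :=
  fun _ hL hprod hlen _ hv => linearIndependent_of_triangular
    (hN.triangular hd hc hm K hL hprod hlen hv)
    (fun i => hN.root_self_ne_zero hd hm K hK (hv i))

theorem IsEulerMatrix.nondegenerate (hN : IsEulerMatrix cs hA d c N)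
    (hd : ∀ i j, A i j * d j = A j i * d i) (hc : IsCoxeterElement cs c) (hm : mov cs hA c = ⊤)
    (K : Type*) [Field K] (hK : ∀ i, (d i : K) ≠ 0) :
    (Matrix.toBilin' (N.map (Int.cast : ℤ → K))).Nondegenerate := by
  obtain ⟨L, hlen, hL, hprod⟩ := exists_reflections_prod_eq cs c
  rw [absLength_of_mov_eq_top hc hm] at hlen
  choose v hv using fun i => exists_isIntRootOf cs hA (hL _ (L.get_mem i))
  exact nondegenerate_of_triangular (by rw [hlen, Module.finrank_fintype_fun_eq_card])
    (hN.triangular hd hc hm K hL hprod hlen hv)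
    (fun i => hN.root_self_ne_zero hd hm K hK (hv i))

theorem IsEulerMatrix.complementExtends (hN : IsEulerMatrix cs hA d c N)
    (hd : ∀ i j, A i j * d j = A j i * d i) (hc : IsCoxeterElement cs c) (hm : mov cs hA c = ⊤)
    (p : ℕ) [Fact p.Prime] (hK : ∀ i, (d i : ZMod p) ≠ 0) :
    ComplementExtends (fun w : NC cs c => movP cs hA p w.1) (kreweras cs c)
      (Matrix.toBilin' (N.map (Int.cast : ℤ → ZMod p))) :=
  complementExtends_movP hc hm (hN.compatibleAt hd hc hm _ hK) (hN.nondegenerate hd hc hm _ hK)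
    fun _ _ hst _ _ hu hv => hN.root_eq_zero hd hc hm _ hst hu hv

theorem isEulerMatrix_wordProd (cs : CoxeterSystem M W)
    (hA : IsCartan M (A.map (Int.cast : ℤ → ℝ))) {l : List B} (hl : ∀ i, i ∈ l)
    (h1 : ∀ i, N i i = d i) (h2 : l.Pairwise fun i j => N i j = 0 ∧ N j i = A j i * d i) :
    IsEulerMatrix cs hA d (cs.wordProd l) N := by
  intro x y
  refine bilinForm_ext_right (fun k => ?_) y
  rw [cartanForm_simpleRoot]
  have e : ∀ i j, Matrix.toBilin' (N.map (Int.cast : ℤ → ℝ)) (simpleRoot i) (simpleRoot j) =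
      N i j := fun i j => by simp [simpleRoot]
  refine bilin_sub_wordProd (b := Matrix.toBilin' (N.map (Int.cast : ℤ → ℝ)))
    (d := fun i => (d i : ℝ)) cs hA (fun i _ => ?_) (h2.imp fun {i j} h => ⟨?_, ?_⟩) x (hl k)
  · rw [e, h1]
  · rw [e, h.1, Int.cast_zero]
  · rw [e, h.2]; simp

/-- For a product of simple reflections, take the matrix that is triangular in the order of the
word. For a conjugate by w, transport it along w⁻¹, which keeps it integral because W preserves the
root lattice. -/
theorem exists_isEulerMatrix (hA : IsCartan M (A.map (Int.cast : ℤ → ℝ)))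
    (hd : ∀ i j, A i j * d j = A j i * d i) (hc : IsCoxeterElement cs c) :
    ∃ N, IsEulerMatrix cs hA d c N := by
  obtain ⟨l, hl, hl', w, rfl⟩ := hc
  let E : Matrix B B ℤ := Matrix.of fun i j =>
    if i = j then d i else if l.idxOf j < l.idxOf i then A i j * d j else 0
  have hE : IsEulerMatrix cs hA d (cs.wordProd l) E := by
    refine isEulerMatrix_wordProd cs hA hl' (fun i => by simp [E]) ?_
    rw [List.pairwise_iff_getElem]
    intro i j hi hj hij
    have hne : l[i] ≠ l[j] := fun h => hij.ne ((hl.getElem_inj_iff).1 h)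
    simp [E, hne, hne.symm, hl.idxOf_getElem, hij, hij.le]
  choose z hz using fun i => exists_int_geomRep cs hA w⁻¹ (Pi.single i 1)
  let N : Matrix B B ℤ := Matrix.of fun i j => ∑ k, ∑ m, z i k * E k m * z j m
  refine ⟨N, ?_⟩
  have hNE : Matrix.toBilin' (N.map (Int.cast : ℤ → ℝ)) =
      (Matrix.toBilin' (E.map (Int.cast : ℤ → ℝ))).comp
        (geomRep cs hA w⁻¹ : (B → ℝ) →ₗ[ℝ] (B → ℝ)) (geomRep cs hA w⁻¹ : (B → ℝ) →ₗ[ℝ] (B → ℝ)) := by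
    refine LinearMap.BilinForm.ext_basis (Pi.basisFun ℝ B) fun i j => ?_
    have e : ∀ k : B, geomRep cs hA w⁻¹ (Pi.basisFun ℝ B k) = fun m => (z k m : ℝ) := by
      intro k
      rw [← hz]
      congr 1
      ext m
      simp [Pi.single_apply]
    rw [LinearMap.BilinForm.comp_apply, LinearEquiv.coe_coe, e, e, toBilin'_intCast]
    simp [N]
  intro x y
  rw [hNE, LinearMap.BilinForm.comp_apply, LinearEquiv.coe_coe, map_sub, geomRep_mul_apply,
    geomRep_mul_apply, geomRep_inv_apply_self, hE,
    cartanForm_geomRep cs hA (symm_intCast hd)]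

end IntEuler

/-! ## Skew-automorphisms that extend -/

section Skew

variable {P K V : Type*} [LE P] [Field K] [AddCommGroup V] [Module K V]

/-- `g` extends to the map induced by a linear automorphism, or to the orthogonal complement with
respect to a non-degenerate bilinear form. -/
def LinearlyExtends (f : P → Submodule K V) (g : P → P) : Prop :=
  (IsLatticeAut g ∧ ∃ e : V ≃ₗ[K] V, ∀ w, (f w).map (e : V →ₗ[K] V) = f (g w)) ∨
  (IsLatticeAntiAut g ∧ ∃ b : LinearMap.BilinForm K V, b.Nondegenerate ∧
    ∀ w, b.orthogonal (f w) = f (g w))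

theorem mem_map_equiv {e : V ≃ₗ[K] V} {U : Submodule K V} {y : V} :
    y ∈ U.map (e : V →ₗ[K] V) ↔ e.symm y ∈ U :=
  Submodule.mem_map_equiv U

theorem isLatticeAut_map (e : V ≃ₗ[K] V) :
    IsLatticeAut (fun U : Submodule K V => U.map (e : V →ₗ[K] V)) :=
  ⟨(Submodule.orderIsoMapComap e).bijective, fun _ _ => (Submodule.orderIsoMapComap e).le_iff_le⟩

theorem map_orthogonal (b : LinearMap.BilinForm K V) (e : V ≃ₗ[K] V) (U : Submodule K V) :
    (b.orthogonal U).map (e : V →ₗ[K] V) =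
      (b.comp LinearMap.id (e.symm : V →ₗ[K] V)).orthogonal U := by
  ext y
  rw [mem_map_equiv]
  rfl

theorem orthogonal_map (b : LinearMap.BilinForm K V) (e : V ≃ₗ[K] V) (U : Submodule K V) :
    b.orthogonal (U.map (e : V →ₗ[K] V)) =
      (b.comp (e : V →ₗ[K] V) LinearMap.id).orthogonal U := by
  ext y
  simp only [LinearMap.BilinForm.mem_orthogonal_iff, Submodule.mem_map, LinearEquiv.coe_coe,
    forall_exists_index, and_imp, forall_apply_eq_imp_iff₂, LinearMap.BilinForm.comp_apply,
    LinearMap.id_apply]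

theorem LinearlyExtends.one {f : P → Submodule K V} : LinearlyExtends f (1 : Equiv.Perm P) :=
  Or.inl ⟨⟨Function.bijective_id, fun _ _ => Iff.rfl⟩, LinearEquiv.refl K V, fun w => by simp⟩

variable [FiniteDimensional K V] {f : P → Submodule K V}

theorem nondegenerate_comp {b : LinearMap.BilinForm K V} (hb : b.Nondegenerate) (e e' : V ≃ₗ[K] V) :
    (b.comp (e : V →ₗ[K] V) (e' : V →ₗ[K] V)).Nondegenerate := by
  refine LinearMap.BilinForm.Nondegenerate.ofSeparatingLeft fun x hx => ?_
  refine e.map_eq_zero_iff.1 (hb.1 _ fun y => ?_)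
  simpa using hx (e'.symm y)

/-- Define e by b'(x, e u) = b(u, x). Then the b-complement of U is the left b'-complement of e(U),
and the right b'-complement undoes it. -/
theorem orthogonal_orthogonal_eq_map {b b' : LinearMap.BilinForm K V} (hb : b.Nondegenerate)
    (hb' : b'.Nondegenerate) :
    ∃ e : V ≃ₗ[K] V, ∀ U, b'.orthogonal (b.orthogonal U) = U.map (e : V →ₗ[K] V) := by
  refine ⟨(b.toDual hb).trans (b'.flip.toDual hb'.flip).symm, fun U => ?_⟩
  set e := (b.toDual hb).trans (b'.flip.toDual hb'.flip).symm
  have he : ∀ u x, b'.flip (e u) x = b u x := fun u x =>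
    LinearMap.BilinForm.apply_toDual_symm_apply (B := b'.flip) (hB := hb'.flip) (b.toDual hb u) x
  have : b.orthogonal U = b'.flip.orthogonal (U.map (e : V →ₗ[K] V)) := by
    ext x
    simp only [LinearMap.BilinForm.mem_orthogonal_iff, Submodule.mem_map, LinearEquiv.coe_coe,
      forall_exists_index, and_imp, forall_apply_eq_imp_iff₂, he]
  rw [this, orthogonal_flip_orthogonal hb']

/-- Linear maps compose, a complement preceded or followed by a linear map is the complement of a
twisted form, and two complements compose to a linear map. Restricting to maps of linear origin is
what keeps a form available for every anti-automorphism. -/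
theorem LinearlyExtends.mul {g h : Equiv.Perm P} (hg : LinearlyExtends f g)
    (hh : LinearlyExtends f h) : LinearlyExtends f ((g * h : Equiv.Perm P)) := by
  have hbij : Function.Bijective (g * h : Equiv.Perm P) := (g * h).bijective
  rcases hg with ⟨hg, e, he⟩ | ⟨hg, b, hb, he⟩ <;> rcases hh with ⟨hh, e', he'⟩ | ⟨hh, b', hb', he'⟩
  · refine Or.inl ⟨⟨hbij, fun x y => (hg.2 _ _).trans (hh.2 _ _)⟩, e'.trans e, fun w => ?_⟩
    rw [Equiv.Perm.mul_apply, ← he, ← he', LinearEquiv.coe_trans, Submodule.map_comp]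
  · refine Or.inr ⟨⟨hbij, fun x y => (hg.2 _ _).trans (hh.2 _ _)⟩, _,
      nondegenerate_comp hb' (LinearEquiv.refl K V) e.symm, fun w => ?_⟩
    rw [Equiv.Perm.mul_apply, ← he, ← he', map_orthogonal]
    rfl
  · refine Or.inr ⟨⟨hbij, fun x y => (hg.2 _ _).trans (hh.2 _ _)⟩, _,
      nondegenerate_comp hb e' (LinearEquiv.refl K V), fun w => ?_⟩
    rw [Equiv.Perm.mul_apply, ← he, ← he', orthogonal_map]
    rfl
  · obtain ⟨e, h⟩ := orthogonal_orthogonal_eq_map hb' hb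
    refine Or.inl ⟨⟨hbij, fun x y => (hg.2 _ _).trans (hh.2 _ _)⟩, e, fun w => ?_⟩
    rw [Equiv.Perm.mul_apply, ← he, ← he', h]

theorem LinearlyExtends.inv {g : Equiv.Perm P} (hg : LinearlyExtends f g) :
    LinearlyExtends f (g⁻¹ : Equiv.Perm P) := by
  rcases hg with ⟨hg, e, he⟩ | ⟨hg, b, hb, he⟩
  · refine Or.inl ⟨⟨(g⁻¹).bijective, fun x y => ?_⟩, e.symm, fun w => ?_⟩
    · rw [← hg.2]; simp
    · conv_lhs => rw [← (g.apply_symm_apply w : g (g⁻¹ w) = w), ← he]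
      rw [← Submodule.map_comp]
      simp
  · refine Or.inr ⟨⟨(g⁻¹).bijective, fun x y => ?_⟩, b.flip, hb.flip, fun w => ?_⟩
    · rw [← hg.2]; simp
    · conv_lhs => rw [← (g.apply_symm_apply w : g (g⁻¹ w) = w), ← he]
      exact flip_orthogonal_orthogonal hb _

theorem LinearlyExtends.skewExtends {g : P → P} (hg : LinearlyExtends f g) : SkewExtends f g := by
  rcases hg with ⟨hg, e, he⟩ | ⟨hg, b, hb, he⟩
  · exact Or.inl ⟨hg, _, isLatticeAut_map e, he⟩
  · exact Or.inr ⟨b, hb, hg, isLatticeAntiAut_orthogonal hb, he⟩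

end Skew

/-! ### Extending the dihedral group from its generators -/

section Dihedral

variable {B W : Type*} [Group W] {M : CoxeterMatrix B} {cs : CoxeterSystem M W}

theorem skewExtends_of_mem_dihedral {K V : Type*} [Field K] [AddCommGroup V] [Module K V]
    [FiniteDimensional K V] {c l r : W} (hb : IsBipartition c l r) {f : NC cs c → Submodule K V}
    (e : V ≃ₗ[K] V) (he : ∀ w, (f w).map (e : V →ₗ[K] V) = f (phiLeft cs hb w))
    {b : LinearMap.BilinForm K V} (hnd : b.Nondegenerate)
    (hext : ComplementExtends f (kreweras cs c) b) {g : Equiv.Perm (NC cs c)}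
    (hg : g ∈ dihedral cs hb) : SkewExtends f g := by
  refine LinearlyExtends.skewExtends ?_
  induction hg using Subgroup.closure_induction with
  | mem g hg =>
    rcases hg with rfl | rfl
    · exact Or.inl ⟨isLatticeAut_phiLeft cs hb, e, he⟩
    · exact Or.inr ⟨hext.1, b, hnd, hext.2.2⟩
  | one => exact LinearlyExtends.one
  | mul g h _ _ hg hh => exact hg.mul hh
  | inv g _ hg => exact hg.inv

variable [Fintype B] [DecidableEq B]

theorem mov_phiLeft {A : Matrix B B ℝ} (hA : IsCartan M A) {c l r : W} (hb : IsBipartition c l r)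
    (w : NC cs c) : (mov cs hA w.1).map (geomRep cs hA l : (B → ℝ) →ₗ[ℝ] (B → ℝ)) =
      mov cs hA (phiLeft cs hb w).1 := by
  change _ = mov cs hA (l * w.1⁻¹ * l)
  have hl : l⁻¹ = l := inv_eq_of_mul_eq_one_left hb.left
  rw [← mov_inv, ← mov_conj, hl]

/-- The involution l acts on the root lattice by an integral matrix Z with Z² = 1, and this identity
survives reduction modulo p. -/
theorem exists_equiv_reduceSubspace {A : Matrix B B ℤ} (cs : CoxeterSystem M W)
    (hA : IsCartan M (A.map (Int.cast : ℤ → ℝ))) (p : ℕ) [Fact p.Prime] {l : W}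
    (hl : l * l = 1) :
    ∃ e : (B → ZMod p) ≃ₗ[ZMod p] (B → ZMod p), ∀ U : Submodule ℝ (B → ℝ),
      (reduceSubspace p U).map (e : (B → ZMod p) →ₗ[ZMod p] (B → ZMod p)) =
        reduceSubspace p (U.map (geomRep cs hA l : (B → ℝ) →ₗ[ℝ] (B → ℝ))) := by
  choose z hz using fun i => exists_int_geomRep cs hA l (Pi.single i 1)
  let Z : Matrix B B ℤ := Matrix.of z
  have hR : (geomRep cs hA l : (B → ℝ) →ₗ[ℝ] (B → ℝ)) =
      Matrix.vecMulLinear (Z.map (Int.cast : ℤ → ℝ)) := by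
    refine (Pi.basisFun ℝ B).ext fun i => ?_
    have h1 : (Pi.basisFun ℝ B) i = fun k => ((Pi.single i 1 : B → ℤ) k : ℝ) := by
      ext k
      simp [Pi.single_apply]
    rw [LinearEquiv.coe_coe, h1, hz]
    ext k
    simp [Matrix.vecMul, dotProduct, Z, Pi.single_apply]
  have hint : ∀ y : B → ℤ, geomRep cs hA l (fun k => (y k : ℝ)) =
      fun k => ((Matrix.vecMul y Z k : ℤ) : ℝ) := by
    intro y
    rw [← LinearEquiv.coe_coe, hR]
    ext k
    simp [Matrix.vecMul, dotProduct]
  have hZ : Z * Z = 1 := by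
    ext i j
    have h1 : Matrix.vecMul (Matrix.vecMul (Pi.single i 1) Z) Z = Pi.single i 1 := by
      ext k
      have h2 := geomRep_mul_apply cs hA l l (fun k => ((Pi.single i 1 : B → ℤ) k : ℝ))
      rw [hl, map_one, hint, hint, LinearEquiv.coe_one, id_eq] at h2
      exact_mod_cast (congrFun h2 k).symm
    have h3 := congrFun h1 j
    rw [Matrix.vecMul_vecMul, Matrix.single_one_vecMul] at h3
    simpa [Matrix.one_apply, Pi.single_apply, eq_comm] using h3
  let F := Matrix.vecMulLinear (Z.map (Int.cast : ℤ → ZMod p))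
  have hF : ∀ x, F (F x) = x := by
    intro x
    have h1 : Z.map (Int.cast : ℤ → ZMod p) * Z.map (Int.cast : ℤ → ZMod p) = 1 := by
      have := congrArg (fun X : Matrix B B ℤ => X.map (Int.castRingHom (ZMod p))) hZ
      rwa [Matrix.map_mul, Matrix.map_one _ (map_zero _) (map_one _)] at this
    simp [F, Matrix.vecMul_vecMul, h1]
  have hle : ∀ U : Submodule ℝ (B → ℝ), (reduceSubspace p U).map F ≤
      reduceSubspace p (U.map (geomRep cs hA l : (B → ℝ) →ₗ[ℝ] (B → ℝ))) := by
    intro U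
    rw [reduceSubspace, Submodule.map_span, Submodule.span_le]
    rintro _ ⟨_, ⟨y, hy, rfl⟩, rfl⟩
    refine Submodule.subset_span ⟨Matrix.vecMul y Z, ⟨_, hy, hint y⟩, ?_⟩
    ext k
    simp [F, Matrix.vecMul, dotProduct]
  refine ⟨LinearEquiv.ofLinearMap F F (LinearMap.ext hF) (LinearMap.ext hF), fun U => ?_⟩
  refine le_antisymm (hle U) fun x hx => ⟨F x, ?_, hF x⟩
  -- The reverse inclusion is the one already shown, applied to l(U), because l and its reduction
  -- are involutions.
  have h1 := hle _ (Submodule.mem_map_of_mem hx)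
  rw [← Submodule.map_comp] at h1
  have h2 : (geomRep cs hA l : (B → ℝ) →ₗ[ℝ] (B → ℝ)) ∘ₗ
      (geomRep cs hA l : (B → ℝ) →ₗ[ℝ] (B → ℝ)) = LinearMap.id := by
    ext1 i
    ext1
    simp [← geomRep_mul_apply, hl]
  rwa [h2, Submodule.map_id] at h1

end Dihedral

/-! ## The classical types -/

/-- Two Cartan matrices of the same forest are conjugate by a diagonal matrix, provided that every
node has at most one smaller neighbour. -/
theorem exists_scaling {n : ℕ} {M : CoxeterMatrix (Fin n)} {A A' : Matrix (Fin n) (Fin n) ℝ}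
    (hA : IsCartan M A) (hA' : IsCartan M A') (hM : ∀ i j, M i j ≠ 0)
    (hpar : ∀ i j j', j < i → j' < i → A' i j ≠ 0 → A' i j' ≠ 0 → j = j') :
    ∃ x : Fin n → ℝ, (∀ i, x i ≠ 0) ∧ ∀ i j, A i j * x j = x i * A' i j := by
  have hprod : ∀ i j, i ≠ j → A i j * A j i = A' i j * A' j i := fun i j hij => by
    rw [hA.prod i j hij (hM i j), hA'.prod i j hij (hM i j)]
  have hzero : ∀ i j, i ≠ j → A' i j = 0 → A i j = 0 := by
    intro i j hij h
    have := hprod i j hij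
    rw [h, zero_mul] at this
    exact (mul_eq_zero.1 this).elim id fun h => hA.zero _ _ h
  suffices H : ∀ k : ℕ, k ≤ n → ∃ x : Fin n → ℝ, (∀ i, x i ≠ 0) ∧
      ∀ i j : Fin n, i.val < k → j.val < k → A i j * x j = x i * A' i j by
    obtain ⟨x, h1, h2⟩ := H n le_rfl
    exact ⟨x, h1, fun i j => h2 i j i.2 j.2⟩
  intro k
  induction k with
  | zero => exact fun _ => ⟨fun _ => 1, fun _ => one_ne_zero, fun i j hi => by omega⟩
  | succ k ih =>
    intro hk
    obtain ⟨x, h1, h2⟩ := ih (by omega)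
    let m : Fin n := ⟨k, by omega⟩
    -- Scaling factors are built node by node. Only the edge from the new node m to its smaller
    -- neighbour, if there is one, constrains y.
    suffices H : ∃ y : ℝ, y ≠ 0 ∧ ∀ j < m, A m j * x j = y * A' m j ∧ A j m * y = x j * A' j m by
      obtain ⟨y, hy, h3⟩ := H
      refine ⟨Function.update x m y, fun i => ?_, fun i j hi hj => ?_⟩
      · by_cases him : i = m
        · rw [him, Function.update_self]; exact hy
        · rw [Function.update_of_ne him]; exact h1 i
      · have hlt : ∀ i : Fin n, i.val < k + 1 → i ≠ m → i < m := fun i hi him => by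
          rw [Fin.lt_def]
          have : i.val ≠ k := fun h => him (Fin.ext h)
          change i.val < k
          omega
        by_cases him : i = m <;> by_cases hjm : j = m
        · rw [him, hjm, hA.diag, hA'.diag, mul_comm]
        · rw [him, Function.update_self, Function.update_of_ne hjm]
          exact (h3 j (hlt j hj hjm)).1
        · rw [hjm, Function.update_self, Function.update_of_ne him]
          exact (h3 i (hlt i hi him)).2
        · rw [Function.update_of_ne him, Function.update_of_ne hjm]
          exact h2 i j (hlt i hi him) (hlt j hj hjm)
    by_cases hex : ∃ j, j < m ∧ A' m j ≠ 0
    · obtain ⟨j, hj, hne⟩ := hex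
      have hAne : A m j ≠ 0 := by
        intro h
        have := hprod m j hj.ne'
        rw [h, zero_mul] at this
        exact hne ((mul_eq_zero.1 this.symm).elim id fun h => hA'.zero _ _ h)
      -- One orientation of the edge determines y. The other follows because the products A m j * A
      -- j m and A' m j * A' j m agree.
      refine ⟨A m j * x j / A' m j, div_ne_zero (mul_ne_zero hAne (h1 j)) hne, fun j' hj' => ?_⟩
      by_cases hjj : j' = j
      · subst hjj
        refine ⟨by field_simp, ?_⟩
        have := hprod m j' hj'.ne'
        field_simp
        linear_combination x j' * this
      · have h0 : A' m j' = 0 := by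
          by_contra h
          exact hjj (hpar m j' j hj' hj h hne)
        have h0' := hA'.zero _ _ h0
        rw [h0, h0', hzero _ _ hj'.ne' h0, hzero _ _ hj'.ne h0']
        simp
    · push Not at hex
      refine ⟨1, one_ne_zero, fun j hj => ?_⟩
      have h0 := hex j hj
      have h0' := hA'.zero _ _ h0
      rw [h0, h0', hzero _ _ hj.ne' h0, hzero _ _ hj.ne h0']
      simp

namespace ClassicalType

/-- Half of the squared length of the simple roots. -/
def halfNorm (X : ClassicalType) (n : ℕ) (i : Fin n) : ℤ :=
  match X with
  | A => 1
  | B => if i.val + 1 = n then 1 else 2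
  | D => 2

/-- The values of `b_X` on pairs of simple roots. -/
def eulerMatrix (X : ClassicalType) (n : ℕ) : Matrix (Fin n) (Fin n) ℤ :=
  Matrix.of fun i j =>
    if i = j then X.halfNorm n i else if j < i then X.cartan n i j * X.halfNorm n j else 0

theorem cartan_mul_halfNorm (X : ClassicalType) (n : ℕ) (i j : Fin n) :
    X.cartan n i j * X.halfNorm n j = X.cartan n j i * X.halfNorm n i := by
  cases X
  · simp only [cartan, halfNorm, CartanMatrix.A, Matrix.of_apply, Fin.ext_iff]
    split_ifs <;> omega
  · simp only [cartan, halfNorm, CartanMatrix.B, Matrix.of_apply, Fin.ext_iff]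
    split_ifs <;> omega
  · simp only [cartan, halfNorm, CartanMatrix.D, Matrix.of_apply, Fin.ext_iff]
    split_ifs <;> omega

/-- This is where p = 2 has to be excluded in types B and D. -/
theorem halfNorm_cast_ne_zero {X : ClassicalType} {n : ℕ} {K : Type*} [Field K]
    (h : X = A ∨ (2 : K) ≠ 0) (i : Fin n) : (X.halfNorm n i : K) ≠ 0 := by
  cases X
  · simp [halfNorm]
  · have h2 : (2 : K) ≠ 0 := h.resolve_left (by simp)
    simp only [halfNorm]
    split_ifs <;> simp [h2]
  · have h2 : (2 : K) ≠ 0 := h.resolve_left (by simp)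
    simp [halfNorm, h2]

theorem coxeterMatrix_ne_zero (X : ClassicalType) (n : ℕ) (i j : Fin n) :
    X.coxeterMatrix n i j ≠ 0 := by
  cases X
  · simp only [coxeterMatrix, CoxeterMatrix.A, Matrix.of_apply]
    split_ifs <;> norm_num
  · simp only [coxeterMatrix, CoxeterMatrix.B, Matrix.of_apply]
    split_ifs <;> norm_num
  · simp only [coxeterMatrix, coxeterMatrixD, Matrix.of_apply]
    split_ifs <;> norm_num

theorem cartan_parent (X : ClassicalType) (n : ℕ) (i j j' : Fin n) (hj : j < i) (hj' : j' < i)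
    (h : X.cartan n i j ≠ 0) (h' : X.cartan n i j' ≠ 0) : j = j' := by
  rw [Fin.lt_def] at hj hj'
  cases X
  · simp only [cartan, CartanMatrix.A, Matrix.of_apply, Fin.ext_iff] at *
    split_ifs at h h' <;> omega
  · simp only [cartan, CartanMatrix.B, Matrix.of_apply, Fin.ext_iff] at *
    split_ifs at h h' <;> omega
  · simp only [cartan, CartanMatrix.D, Matrix.of_apply, Fin.ext_iff] at *
    split_ifs at h h' <;> omega

/-! ### The forms b_X in the coordinates of the simple roots -/

theorem simpleVec_of_lt (X : ClassicalType) {n : ℕ} (K : Type*) [Ring K] {i : Fin n}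
    (h : i.val + 1 < n) :
    X.simpleVec n K i = Pi.single i 1 - Pi.single ⟨i.val + 1, h⟩ 1 := by
  have h1 : i.val + 1 ≠ n := h.ne
  ext k
  cases X <;> simp only [simpleVec, if_neg h1, Pi.sub_apply, Pi.single_apply, Fin.ext_iff] <;>
    split_ifs <;> first | omega | simp

theorem simpleVec_last {X : ClassicalType} (hX : X ≠ D) {n : ℕ} (K : Type*) [Ring K] {i : Fin n}
    (h : i.val + 1 = n) : X.simpleVec n K i = Pi.single i 1 := by
  ext k
  have hk := k.2
  cases X
  · simp only [simpleVec, Pi.single_apply, Fin.ext_iff]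
    split_ifs <;> first | omega | simp
  · simp only [simpleVec, Pi.single_apply, Fin.ext_iff]
    split_ifs <;> first | omega | simp
  · exact absurd rfl hX

theorem simpleVec_D_last {n : ℕ} (K : Type*) [Ring K] {i : Fin n}
    (h : i.val + 1 = n) (h' : i.val - 1 < n) (hn : 2 ≤ n) :
    D.simpleVec n K i = Pi.single i 1 + Pi.single ⟨i.val - 1, h'⟩ 1 := by
  ext k
  have hk := k.2
  simp only [simpleVec, if_pos h, Pi.add_apply, Pi.single_apply, Fin.ext_iff]
  split_ifs <;> first | omega | simp

theorem sum_simpleVec_mul_of_lt (X : ClassicalType) {n : ℕ} {K : Type*} [Ring K] {i : Fin n}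
    (h : i.val + 1 < n) (f : Fin n → K) :
    ∑ k, X.simpleVec n K i k * f k = f i - f ⟨i.val + 1, h⟩ := by
  simp [simpleVec_of_lt X K h, sub_mul, Finset.sum_sub_distrib, Pi.single_apply]

theorem sum_simpleVec_mul_last {X : ClassicalType} (hX : X ≠ D) {n : ℕ} {K : Type*} [Ring K]
    {i : Fin n} (h : i.val + 1 = n) (f : Fin n → K) :
    ∑ k, X.simpleVec n K i k * f k = f i := by
  simp [simpleVec_last hX K h, Pi.single_apply]

theorem sum_simpleVec_mul_D_last {n : ℕ} {K : Type*} [Ring K] {i : Fin n}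
    (h : i.val + 1 = n) (h' : i.val - 1 < n) (hn : 2 ≤ n) (f : Fin n → K) :
    ∑ k, D.simpleVec n K i k * f k = f i + f ⟨i.val - 1, h'⟩ := by
  simp [simpleVec_D_last K h h' hn, add_mul, Finset.sum_add_distrib, Pi.single_apply]

/-- The values of the form on a simple root and a basis vector. -/
theorem sum_simpleVec_gram (X : ClassicalType) {n : ℕ} (hn : X.minRank ≤ n) (K : Type*) [Field K]
    (i l : Fin n) : ∑ k, X.simpleVec n K i k * X.gram n K k l =
      match X with
      | A => if l = i then 1 else 0
      | B => if i.val + 1 = n then (if l = i then 1 else -1) else if l = i then 2 else 0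
      | D =>
        if i.val + 2 < n then (if l = i then 2 else 0)
        else if l.val + 2 < n then -1
        else if l.val + 2 = n then 1 else if i.val + 1 = n then 1 else -1 := by
  have hl := l.2
  have hi := i.2
  by_cases h : i.val + 1 < n
  · rw [sum_simpleVec_mul_of_lt X h]
    cases X <;> simp only [gram, Matrix.of_apply, Fin.ext_iff, Fin.le_def, Fin.lt_def] <;>
      split_ifs <;> first | omega | norm_num
  · have h' : i.val + 1 = n := by omega
    cases X
    · rw [sum_simpleVec_mul_last (by simp) h']
      simp only [gram, Matrix.of_apply, Fin.ext_iff, Fin.le_def]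
      split_ifs <;> first | omega | norm_num
    · rw [sum_simpleVec_mul_last (by simp) h']
      simp only [gram, Matrix.of_apply, Fin.ext_iff, Fin.le_def]
      split_ifs <;> first | omega | norm_num
    · simp only [minRank] at hn
      rw [sum_simpleVec_mul_D_last h' (by omega) (by omega)]
      simp only [gram, Matrix.of_apply, Fin.ext_iff, Fin.le_def, Fin.lt_def]
      split_ifs <;> first | omega | norm_num

theorem eulerMatrix_A (n : ℕ) (i j : Fin n) :
    A.eulerMatrix n i j = if i = j then 1 else if j.val + 1 = i.val then -1 else 0 := by
  simp only [eulerMatrix, cartan, halfNorm, CartanMatrix.A, Matrix.of_apply, Fin.ext_iff,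
    Fin.lt_def]
  split_ifs <;> omega

theorem eulerMatrix_B (n : ℕ) (i j : Fin n) :
    B.eulerMatrix n i j = if i = j then (if i.val + 1 = n then 1 else 2)
      else if j.val + 1 = i.val then -2 else 0 := by
  simp only [eulerMatrix, cartan, halfNorm, CartanMatrix.B, Matrix.of_apply, Fin.ext_iff,
    Fin.lt_def]
  split_ifs <;> omega

theorem eulerMatrix_D {n : ℕ} (hn : 3 ≤ n) (i j : Fin n) :
    D.eulerMatrix n i j = if i = j then 2
      else if (j.val + 1 = i.val ∧ i.val + 1 < n) ∨ (j.val + 3 = n ∧ i.val + 1 = n) then -2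
      else 0 := by
  simp only [eulerMatrix, cartan, halfNorm, CartanMatrix.D, Matrix.of_apply, Fin.ext_iff,
    Fin.lt_def]
  split_ifs <;> omega

theorem sum_sum_simpleVec_gram (X : ClassicalType) {n : ℕ} (hn : X.minRank ≤ n) (K : Type*)
    [Field K] (i j : Fin n) :
    ∑ l, X.simpleVec n K j l * ∑ k, X.simpleVec n K i k * X.gram n K k l =
      (X.eulerMatrix n i j : K) := by
  have hi := i.2
  have hj := j.2
  simp only [sum_simpleVec_gram X hn]
  by_cases h : j.val + 1 < n
  · rw [sum_simpleVec_mul_of_lt X h]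
    cases X
    · simp only [eulerMatrix_A, Fin.ext_iff]
      split_ifs <;> first | omega | norm_num
    · simp only [eulerMatrix_B, Fin.ext_iff]
      split_ifs <;> first | omega | norm_num
    · rw [eulerMatrix_D hn]
      simp only [Fin.ext_iff]
      split_ifs <;> first | omega | norm_num
  · have h' : j.val + 1 = n := by omega
    cases X
    · rw [sum_simpleVec_mul_last (by simp) h', eulerMatrix_A]
      simp only [Fin.ext_iff]
      split_ifs <;> first | omega | norm_num
    · rw [sum_simpleVec_mul_last (by simp) h', eulerMatrix_B]
      simp only [Fin.ext_iff]
      split_ifs <;> first | omega | norm_num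
    · simp only [minRank] at hn
      rw [sum_simpleVec_mul_D_last h' (by omega) (by omega), eulerMatrix_D hn]
      simp only [Fin.ext_iff]
      split_ifs <;> first | omega | norm_num

theorem form_apply (X : ClassicalType) (n : ℕ) (K : Type*) [Field K] (x y : Fin n → K) :
    X.form n K x y = ∑ k, ∑ l, (Fintype.linearCombination K (X.simpleVec n K) x) k *
      X.gram n K k l * (Fintype.linearCombination K (X.simpleVec n K) y) l := by
  rw [form, LinearMap.BilinForm.comp_apply, Matrix.toBilin'_apply]

/-- This identifies the explicit form with the integral Euler form of s_1 ⋯ s_n. In types B and D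
the symmetrization of b_X is twice the standard inner product, whence the normalization of
`halfNorm`. -/
theorem form_eq_toBilin' (X : ClassicalType) {n : ℕ} (hn : X.minRank ≤ n) (K : Type*) [Field K] :
    X.form n K = Matrix.toBilin' ((X.eulerMatrix n).map (Int.cast : ℤ → K)) := by
  refine LinearMap.BilinForm.ext_basis (Pi.basisFun K (Fin n)) fun i j => ?_
  rw [Pi.basisFun_apply, Pi.basisFun_apply, Matrix.toBilin'_single, Matrix.map_apply,
    ← sum_sum_simpleVec_gram X hn, form_apply]
  simp only [Fintype.linearCombination_apply_single, one_smul]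
  rw [Finset.sum_comm]
  refine Finset.sum_congr rfl fun l _ => ?_
  rw [Finset.mul_sum]
  exact Finset.sum_congr rfl fun k _ => by ring

theorem eulerMatrix_add_transpose (X : ClassicalType) (n : ℕ) (i j : Fin n) :
    X.eulerMatrix n i j + X.eulerMatrix n j i = X.cartan n i j * X.halfNorm n j := by
  simp only [eulerMatrix, Matrix.of_apply]
  rcases lt_trichotomy i j with h | rfl | h
  · rw [if_neg h.ne, if_neg h.not_gt, if_neg h.ne', if_pos h, zero_add, cartan_mul_halfNorm]
  · have : X.cartan n i i = 2 := by
      cases X <;> simp [cartan, CartanMatrix.A]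
    rw [if_pos rfl, this]
    ring
  · rw [if_neg h.ne', if_pos h, if_neg h.ne, if_neg h.not_gt, add_zero]

theorem isEulerMatrix (X : ClassicalType) (n : ℕ) {W : Type*} [Group W]
    (cs : CoxeterSystem (X.coxeterMatrix n) W) :
    IsEulerMatrix cs (X.isCartan n) (X.halfNorm n) (cs.wordProd (List.finRange n))
      (X.eulerMatrix n) := by
  refine isEulerMatrix_wordProd cs _ List.mem_finRange (fun i => by simp [eulerMatrix]) ?_
  refine (List.pairwise_lt_finRange n).imp fun {i j} h => ⟨?_, ?_⟩
  · simp [eulerMatrix, h.ne, h.not_gt]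
  · simp [eulerMatrix, h.ne', h]

/-- In the basis e the symmetrized form is ∑ y_k² + (∑ y_k)² in type A and 2 ∑ y_k² in types B and
D. The resulting positivity replaces finiteness of W. -/
theorem two_mul_form_self (X : ClassicalType) {n : ℕ} (x : Fin n → ℝ) :
    ∑ k, (Fintype.linearCombination ℝ (X.simpleVec n ℝ) x) k ^ 2 ≤ 2 * X.form n ℝ x x := by
  rw [form_apply]
  set y := Fintype.linearCombination ℝ (X.simpleVec n ℝ) x
  have h1 : 2 * ∑ k, ∑ l, y k * X.gram n ℝ k l * y l =
      ∑ k, ∑ l, (X.gram n ℝ k l + X.gram n ℝ l k) * (y k * y l) := by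
    rw [two_mul]
    nth_rewrite 2 [Finset.sum_comm]
    rw [← Finset.sum_add_distrib]
    refine Finset.sum_congr rfl fun k _ => ?_
    rw [← Finset.sum_add_distrib]
    exact Finset.sum_congr rfl fun l _ => by ring
  rw [h1]
  cases X
  · have hg : ∀ k l : Fin n, (A.gram n ℝ k l + A.gram n ℝ l k) * (y k * y l) =
        y k * y l + if k = l then y k * y l else 0 := by
      intro k l
      simp only [gram, Matrix.of_apply, Fin.ext_iff, Fin.le_def]
      split_ifs <;> first | omega | ring
    simp only [hg, Finset.sum_add_distrib, Finset.sum_ite_eq, Finset.mem_univ, if_true,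
      ← Finset.mul_sum, ← Finset.sum_mul, ← sq]
    exact le_add_of_nonneg_left (sq_nonneg _)
  · have hg : ∀ k l : Fin n, (B.gram n ℝ k l + B.gram n ℝ l k) * (y k * y l) =
        if k = l then 2 * (y k * y l) else 0 := by
      intro k l
      simp only [gram, Matrix.of_apply, Fin.ext_iff, Fin.le_def]
      split_ifs <;> first | omega | ring
    simp only [hg, Finset.sum_ite_eq, Finset.mem_univ, if_true]
    exact Finset.sum_le_sum fun k _ => by nlinarith [sq_nonneg (y k)]
  · have hg : ∀ k l : Fin n, (D.gram n ℝ k l + D.gram n ℝ l k) * (y k * y l) =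
        if k = l then 2 * (y k * y l) else 0 := by
      intro k l
      have hk := k.2
      have hl := l.2
      simp only [gram, Matrix.of_apply, Fin.ext_iff, Fin.le_def, Fin.lt_def]
      split_ifs <;> first | omega | ring
    simp only [hg, Finset.sum_ite_eq, Finset.mem_univ, if_true]
    exact Finset.sum_le_sum fun k _ => by nlinarith [sq_nonneg (y k)]

/-- If all simple coroots vanish at x, then (x, x) = 2 b_X(x, x) = 0, so positivity makes the
coordinates of x in the basis e vanish. Then b_X(x, ·) = 0, and the triangular matrix of b_X in the
simple roots forces x = 0. -/
theorem fixedPointFree (X : ClassicalType) {n : ℕ} (hn : X.minRank ≤ n) :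
    FixedPointFree ((X.cartan n).map (Int.cast : ℤ → ℝ)) := by
  intro x hx
  have h0 : cartanForm ((X.cartan n).map (Int.cast : ℤ → ℝ)) (fun i => (X.halfNorm n i : ℝ)) x x =
      0 := by
    have := bilinForm_ext_right (b' := 0) (x := x) (x' := x)
      (b := cartanForm ((X.cartan n).map (Int.cast : ℤ → ℝ)) (fun i => (X.halfNorm n i : ℝ)))
      (fun j => by rw [cartanForm_simpleRoot, hx]; simp) x
    rw [this]
    simp
  have h1 : 2 * X.form n ℝ x x = 0 := by
    rw [← h0, form_eq_toBilin' X hn, cartanForm, Matrix.toBilin'_apply, Matrix.toBilin'_apply,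
      two_mul]
    nth_rewrite 2 [Finset.sum_comm]
    rw [← Finset.sum_add_distrib]
    refine Finset.sum_congr rfl fun k _ => ?_
    rw [← Finset.sum_add_distrib]
    refine Finset.sum_congr rfl fun l _ => ?_
    have h2 := congrArg (Int.cast : ℤ → ℝ) (eulerMatrix_add_transpose X n k l)
    push_cast at h2
    rw [Matrix.mul_diagonal]
    simp only [Matrix.map_apply, ← h2]
    ring
  have h2 : Fintype.linearCombination ℝ (X.simpleVec n ℝ) x = 0 := by
    have h3 := two_mul_form_self X x
    rw [h1] at h3
    have h4 := (Finset.sum_eq_zero_iff_of_nonneg fun k _ => sq_nonneg _).1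
      (le_antisymm h3 (Finset.sum_nonneg fun k _ => sq_nonneg _))
    ext k
    exact pow_eq_zero_iff two_ne_zero |>.1 (h4 k (Finset.mem_univ k))
  have hnd : (X.form n ℝ).Nondegenerate := by
    rw [form_eq_toBilin' X hn, LinearMap.BilinForm.nondegenerate_toBilin'_iff_det_ne_zero,
      Matrix.det_of_isLowerTriangular]
    · refine Finset.prod_ne_zero_iff.2 fun i _ => ?_
      have := halfNorm_cast_ne_zero (X := X) (K := ℝ) (Or.inr two_ne_zero) i
      simpa [eulerMatrix] using this
    · intro i j hij
      have hij : i < j := hij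
      simp [eulerMatrix, hij.ne, hij.not_gt]
  refine hnd.1 x fun y => ?_
  rw [form_apply, h2]
  simp

/-- Every real normalization of the roots is a diagonal rescaling by some x of the crystallographic
one. Fixed vectors v correspond to (v_i x_i), and half squared lengths get multiplied by x_i². -/
theorem exists_symmetrization (X : ClassicalType) {n : ℕ} (hn : X.minRank ≤ n)
    {A : Matrix (Fin n) (Fin n) ℝ} (hA : IsCartan (X.coxeterMatrix n) A) :
    FixedPointFree A ∧ ∃ d : Fin n → ℝ, (∀ i, d i ≠ 0) ∧ ∀ i j, A i j * d j = A j i * d i := by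
  obtain ⟨x, hx, h⟩ := exists_scaling hA (X.isCartan n) (X.coxeterMatrix_ne_zero n)
    (fun i j j' hj hj' h h' => X.cartan_parent n i j j' hj hj' (by simpa using h) (by simpa using h'))
  refine ⟨fun v hv => ?_, fun i => X.halfNorm n i * x i ^ 2, fun i => ?_, fun i j => ?_⟩
  · have h0 : (fun i => v i * x i) = 0 := by
      refine X.fixedPointFree hn _ fun j => ?_
      have h1 := hv j
      simp only [coroot, LinearMap.comp_apply, LinearMap.proj_apply, Matrix.vecMulLinear_apply,
        Matrix.vecMul, dotProduct] at h1 ⊢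
      have h2 := congrArg (· * x j) h1
      simp only [Finset.sum_mul, zero_mul, mul_assoc, h] at h2
      simpa only [mul_assoc] using h2
    ext i
    exact (mul_eq_zero.1 (congrFun h0 i)).resolve_right (hx i)
  · exact mul_ne_zero (halfNorm_cast_ne_zero (Or.inr two_ne_zero) i) (pow_ne_zero 2 (hx i))
  · have h1 := symm_intCast (X.cartan_mul_halfNorm n) i j
    linear_combination (X.halfNorm n j * x j) * h i j - (X.halfNorm n i * x i) * h j i +
      (x i * x j) * h1

theorem two_ne_zero_zmod {X : ClassicalType} {p : ℕ} [Fact p.Prime] (h : X = A ∨ p ≠ 2) :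
    X = A ∨ (2 : ZMod p) ≠ 0 := by
  refine h.imp_right fun h => ?_
  have : (2 : ZMod p) = ((2 : ℕ) : ZMod p) := by norm_num
  rw [this, Ne, ZMod.natCast_eq_zero_iff]
  exact fun h2 => h ((Nat.prime_dvd_prime_iff_eq Fact.out Nat.prime_two).1 h2)

end ClassicalType

theorem isCoxeterElement_wordProd {B W : Type*} [Group W] {M : CoxeterMatrix B}
    (cs : CoxeterSystem M W) {l : List B} (h : l.Nodup) (h' : ∀ i, i ∈ l) :
    IsCoxeterElement cs (cs.wordProd l) :=
  ⟨l, h, h', 1, by simp⟩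

end NonCrossing

theorem mainTheorem5 :
    -- the criterion for an arbitrary finite Coxeter group and the real geometric representation
    (∀ {B W : Type*} [Fintype B] [DecidableEq B] [Group W] [Finite W] {M : CoxeterMatrix B}
      (cs : CoxeterSystem M W) (c : W), NonCrossing.IsCoxeterElement cs c →
      ∀ {A : Matrix B B ℝ} (hA : NonCrossing.IsCartan M A) (b : LinearMap.BilinForm ℝ (B → ℝ)),
        b.Nondegenerate →
        (∀ s t, NonCrossing.Subordinates cs c s t → ∀ u v,
          NonCrossing.IsRootOf cs hA s u → NonCrossing.IsRootOf cs hA t v → b u v = 0) →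
        NonCrossing.ComplementExtends (fun w : NonCrossing.NC cs c => NonCrossing.mov cs hA w.1)
          (NonCrossing.kreweras cs c) b) ∧
    -- the criterion for a crystallographic root system and a compatible prime
    (∀ {B W : Type*} [Fintype B] [DecidableEq B] [Group W] [Finite W] {M : CoxeterMatrix B}
      (cs : CoxeterSystem M W) (c : W), NonCrossing.IsCoxeterElement cs c →
      ∀ {A : Matrix B B ℤ} (hA : NonCrossing.IsCartan M (A.map (Int.cast : ℤ → ℝ)))
        (p : ℕ) [Fact p.Prime], NonCrossing.Compatible cs hA p →
      ∀ b : LinearMap.BilinForm (ZMod p) (B → ZMod p), b.Nondegenerate →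
        (∀ s t, NonCrossing.Subordinates cs c s t → ∀ u v : B → ℤ,
          NonCrossing.IsIntRootOf cs hA s u → NonCrossing.IsIntRootOf cs hA t v →
          b (fun i => (u i : ZMod p)) (fun i => (v i : ZMod p)) = 0) →
        NonCrossing.ComplementExtends
          (fun w : NonCrossing.NC cs c => NonCrossing.movP cs hA p w.1)
          (NonCrossing.kreweras cs c) b) ∧
    -- in the classical types, all elements of the dihedral group extend
    (∀ (X : NonCrossing.ClassicalType) (n : ℕ), X.minRank ≤ n →
      ∀ {W : Type*} [Group W] (cs : CoxeterSystem (X.coxeterMatrix n) W) (c l r : W),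
      NonCrossing.IsCoxeterElement cs c → ∀ hb : NonCrossing.IsBipartition c l r,
      ∀ g ∈ NonCrossing.dihedral cs hb,
        (∀ {A : Matrix (Fin n) (Fin n) ℝ} (hA : NonCrossing.IsCartan (X.coxeterMatrix n) A),
          NonCrossing.SkewExtends
            (fun w : NonCrossing.NC cs c => NonCrossing.mov cs hA w.1) g) ∧
        (∀ (p : ℕ) [Fact p.Prime], (X = NonCrossing.ClassicalType.A ∨ p ≠ 2) →
          NonCrossing.SkewExtends
            (fun w : NonCrossing.NC cs c => NonCrossing.movP cs (X.isCartan n) p w.1) g)) ∧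
    -- the explicit forms, for the Coxeter element `s_1 ⋯ s_n`
    (∀ (X : NonCrossing.ClassicalType) (n : ℕ), X.minRank ≤ n →
      ∀ {W : Type*} [Group W] (cs : CoxeterSystem (X.coxeterMatrix n) W) (c : W),
      c = cs.wordProd (List.finRange n) →
        ((X.form n ℝ).Nondegenerate ∧
          (∀ s t, NonCrossing.Subordinates cs c s t → ∀ u v,
            NonCrossing.IsRootOf cs (X.isCartan n) s u →
            NonCrossing.IsRootOf cs (X.isCartan n) t v → X.form n ℝ u v = 0) ∧
          NonCrossing.ComplementExtends
            (fun w : NonCrossing.NC cs c => NonCrossing.mov cs (X.isCartan n) w.1)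
            (NonCrossing.kreweras cs c) (X.form n ℝ)) ∧
        (∀ (p : ℕ) [Fact p.Prime], (X = NonCrossing.ClassicalType.A ∨ p ≠ 2) →
          (X.form n (ZMod p)).Nondegenerate ∧
          (∀ s t, NonCrossing.Subordinates cs c s t → ∀ u v : Fin n → ℤ,
            NonCrossing.IsIntRootOf cs (X.isCartan n) s u →
            NonCrossing.IsIntRootOf cs (X.isCartan n) t v →
            X.form n (ZMod p) (fun i => (u i : ZMod p)) (fun i => (v i : ZMod p)) = 0) ∧
          NonCrossing.ComplementExtends
            (fun w : NonCrossing.NC cs c => NonCrossing.movP cs (X.isCartan n) p w.1)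
            (NonCrossing.kreweras cs c) (X.form n (ZMod p)))) := by
  refine ⟨?_, ?_, ?_, ?_⟩
  · intro B W _ _ _ _ M cs c hc A hA b hb h
    exact NonCrossing.complementExtends_mov hc
      (NonCrossing.mov_coxeterElement cs hA (NonCrossing.fixedPointFree_of_finite cs hA) hc) hb h
  · intro B W _ _ _ _ M cs c hc A hA p _ hp b hb h
    have hm := NonCrossing.mov_coxeterElement cs hA (NonCrossing.fixedPointFree_of_finite cs hA) hc
    exact NonCrossing.complementExtends_movP hc hm (hp.compatibleAt hm) hb h
  · intro X n hn W _ cs c l r hc hb g hg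
    refine ⟨fun {A} hA => ?_, fun p _ hp => ?_⟩
    · obtain ⟨hF, d, hd, hd'⟩ := X.exists_symmetrization hn hA
      obtain ⟨b, hnd, hext⟩ := NonCrossing.exists_nondegenerate_bilin hd' hF hd hc (hA := hA)
      exact NonCrossing.skewExtends_of_mem_dihedral hb _ (NonCrossing.mov_phiLeft hA hb) hnd hext hg
    · have hm := NonCrossing.mov_coxeterElement cs (X.isCartan n) (X.fixedPointFree hn) hc
      have hd := X.cartan_mul_halfNorm n
      have hK := NonCrossing.ClassicalType.halfNorm_cast_ne_zero (n := n)
        (NonCrossing.ClassicalType.two_ne_zero_zmod hp)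
      -- Here c is an arbitrary Coxeter element, so the form modulo p is the reduction of its
      -- integral Euler matrix, not b_X.
      obtain ⟨N, hN⟩ := NonCrossing.exists_isEulerMatrix (X.isCartan n) hd hc
      obtain ⟨e, he⟩ := NonCrossing.exists_equiv_reduceSubspace cs (X.isCartan n) p hb.left
      refine NonCrossing.skewExtends_of_mem_dihedral hb e (fun w => ?_)
        (hN.nondegenerate hd hc hm _ hK) (hN.complementExtends hd hc hm p hK) hg
      exact (he _).trans (congrArg (NonCrossing.reduceSubspace p)
        (NonCrossing.mov_phiLeft (X.isCartan n) hb w))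
  · rintro X n hn W _ cs c rfl
    have hc := NonCrossing.isCoxeterElement_wordProd cs (List.nodup_finRange n) List.mem_finRange
    have hm := NonCrossing.mov_coxeterElement cs (X.isCartan n) (X.fixedPointFree hn) hc
    have hd := X.cartan_mul_halfNorm n
    have hN := X.isEulerMatrix n cs
    refine ⟨?_, fun p _ hp => ?_⟩
    · rw [X.form_eq_toBilin' hn]
      have hnd := hN.nondegenerate hd hc hm ℝ
        (NonCrossing.ClassicalType.halfNorm_cast_ne_zero (Or.inr two_ne_zero))
      have h := fun s t (hst : NonCrossing.Subordinates cs _ s t) u v hu hv =>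
        NonCrossing.bilin_root_eq_zero (NonCrossing.symm_intCast hd) hN hc hm hst (u := u) (v := v)
          hu hv
      exact ⟨hnd, h, NonCrossing.complementExtends_mov hc hm hnd h⟩
    · have hK := NonCrossing.ClassicalType.halfNorm_cast_ne_zero (n := n)
        (NonCrossing.ClassicalType.two_ne_zero_zmod hp)
      rw [X.form_eq_toBilin' hn]
      exact ⟨hN.nondegenerate hd hc hm _ hK,
        fun s t hst u v hu hv => hN.root_eq_zero hd hc hm _ hst hu hv,
        hN.complementExtends hd hc hm p hK⟩
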